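/- Let $\mathbb{F}\in\{\mathbb{R},\mathbb{C}\}$ and let $(\mathbb{X},\|\cdot\|)$ be a quasi-Banach space over $\mathbb{F}$. A \emph{basis} of $\mathbb{X}$ is a norm-bounded family $\mathcal{X}=(x_n)_{n\in\mathcal{N}}$, indexed by a countable set $\mathcal{N}$, whose linear span is dense in $\mathbb{X}$ and for which there is a (necessarily unique) norm-bounded family $(x_n^*)_{n\in\mathcal{N}}$ in $\mathbb{X}^*$ with $x_n^*(x_k)=\delta_{n,k}$. Fix an enumeration of $\mathcal{N}$ to break ties. For $f\in\mathbb{X}$ and $m\ge 1$ (with $m\le|\mathcal{N}|$ if $\mathcal{N}$ is finite) let $A_m(f)\subseteq\mathcal{N}$ be the set of the $m$ indices with the largest $|x_n^*(f)|$ (among equal values, the earlier index is taken first). The basis $\mathcal{X}$ is \emph{truncation quasi-greedy} if there is a constant $C$ such that \[ \Big\|\min_{n\in A_m(f)}|x_n^*(f)|\sum_{n\in A_m(f)}\operatorname{sgn}(x_n^*(f))\,x_n\Big\|\le C\|f\| \] for all such $f$ and $m$, where $\operatorname{sgn}(0)=1$ and $\operatorname{sgn}(a)=a/|a|$ for $a\neq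 0$. A family $\mathcal{Y}=(y_i)_{i\in\mathcal{M}}$ in $\mathbb{X}$ is a (truncation quasi-greedy) \emph{basic sequence} if it is a (truncation quasi-greedy) basis of its closed linear span, and it is \emph{complemented} if this span is the range of a bounded linear projection on $\mathbb{X}$. The lower and upper democracy functions of a family $\mathcal{Z}=(z_n)_{n\in\mathcal{J}}$ in $\mathbb{X}$ are, for $m\ge1$, \[ \varphi_l[\mathcal{Z}](m)=\inf_{|A|\ge m}\Big\|\sum_{n\in A}z_n\Big\|,\qquad \varphi_u[\mathcal{Z}](m)=\sup_{|A|\le m}\Big\|\sum_{n\in A}z_n\Big\|, \] where $A$ runs over finite subsets of $\mathcal{J}$ (and $\inf\emptyset=\infty$). \textbf{Theorem.} Let $\mathcal{X}$ be a truncation quasi-greedy basis of a quasi-Banach space $\mathbb{X}$ such that $\varphi_l[\mathcal{X}]$ is doubling, i.e., there is a constant $C$ with $\varphi_l[\mathcal{X}](2m)\le C\varphi_l[\mathcal{X}](m)$ for all $m\ge 1$, and such that $\sum_{m=1}^\infty 1/\varphi_l[\mathcal{X}](m)<\infty$. Let $\mathcal{Y}=(y_i)_{i\in\mathcal{M}}$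 be a complemented truncation quasi-greedy basic sequence of $\mathbb{X}$. Then there are constants $0<C_1,C_2,C_3<\infty$ such that \[ \varphi_l[\mathcal{X}](m)\le C_1\,\varphi_l[\mathcal{Y}](m),\qquad \varphi_l[\mathcal{Y}](m)\le C_2\,\varphi_u[\mathcal{Y}](m),\qquad \varphi_u[\mathcal{Y}](m)\le C_3\,\varphi_u[\mathcal{X}](m) \] for all integers $m\ge 1$; if $\mathcal{M}$ is finite, the second inequality is claimed only for $m\le|\mathcal{M}|$ (as then $\varphi_l[\mathcal{Y}](m)=\infty$ for $m>|\mathcal{M}|$). -/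

import Mathlib

open scoped NNReal ENNReal Topology

namespace GreedyBases

/-- `q` is a quasi-norm on the `𝕜`-vector space `E`, and the given (translation invariant)
topology of `E` is the one that `q` induces. With `CompleteSpace E` this says that `(E, q)` is a
quasi-Banach space. -/
structure IsQuasiNorm (𝕜 : Type*) {E : Type*} [RCLike 𝕜] [AddCommGroup E] [Module 𝕜 E]
    [TopologicalSpace E] (q : E → ℝ) : Prop where
  nonneg : ∀ f, 0 ≤ q f
  eq_zero_iff : ∀ f, q f = 0 ↔ f = 0
  smul : ∀ (a : 𝕜) (f : E), q (a • f) = ‖a‖ * q f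
  add_le : ∃ κ : ℝ, 1 ≤ κ ∧ ∀ f g, q (f + g) ≤ κ * (q f + q g)
  hasBasis_nhds_zero : (𝓝 (0 : E)).HasBasis (fun ε : ℝ => 0 < ε) (fun ε => {f | q f < ε})

/-- `x` is a basis of `(E, q)` and `xs` is its dual basis: `x` is norm-bounded, its linear span is
dense, and `xs` is a norm-bounded family in the dual space which is biorthogonal to `x`. (The
density of the span makes `xs` unique.) -/
structure IsBasisWithDual {𝕜 E N : Type*} [RCLike 𝕜] [AddCommGroup E] [Module 𝕜 E]
    [TopologicalSpace E] (q : E → ℝ) (x : N → E) (xs : N → E →L[𝕜] 𝕜) : Prop where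
  bounded : ∃ C : ℝ, ∀ n, q (x n) ≤ C
  dense_span : Dense (Submodule.span 𝕜 (Set.range x) : Set E)
  apply_self : ∀ n, xs n (x n) = 1
  apply_ne : ∀ n k, n ≠ k → xs n (x k) = 0
  dual_bounded : ∃ C : ℝ, ∀ n f, ‖xs n f‖ ≤ C * q f

/-- The sign function `a ↦ a / |a|`, with value `1` at `0`. -/
noncomputable def sgn {𝕜 : Type*} [RCLike 𝕜] (a : 𝕜) : 𝕜 :=
  open Classical in if a = 0 then 1 else a / (‖a‖ : 𝕜)

/-- `A` is the set formed by the `|A|` largest coefficients of `a` in absolute value, ties being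
broken by the enumeration `r` of the index set. For each size there is at most one such `A`. -/
def IsGreedySet {𝕜 N : Type*} [RCLike 𝕜] (r : N ↪ ℕ) (a : N → 𝕜) (A : Finset N) : Prop :=
  ∀ i ∈ A, ∀ j, j ∉ A → ‖a j‖ < ‖a i‖ ∨ (‖a i‖ = ‖a j‖ ∧ r i < r j)

/-- The truncation `min_{n ∈ A} |xs n f| * ∑_{n ∈ A} sgn (xs n f) x n` of `f` on the nonempty finite
set `A`. It is the `m`-th restricted truncation of `f` if `A` is the greedy set of `f` of
size `m`. -/
noncomputable def truncation {𝕜 E N : Type*} [RCLike 𝕜] [AddCommGroup E] [Module 𝕜 E]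
    [TopologicalSpace E] (x : N → E) (xs : N → E →L[𝕜] 𝕜) (f : E) (A : Finset N)
    (hA : A.Nonempty) : E :=
  ((A.inf' hA (fun n => ‖xs n f‖) : ℝ) : 𝕜) • ∑ n ∈ A, sgn (xs n f) • x n

/-- `x` is a basis of `(E, q)`, indexed by a countable set, whose restricted truncation operators
are uniformly bounded. -/
def IsTruncationQuasiGreedyBasis (𝕜 : Type*) {E N : Type*} [RCLike 𝕜] [AddCommGroup E] [Module 𝕜 E]
    [TopologicalSpace E] (q : E → ℝ) (x : N → E) : Prop :=
  ∃ xs : N → E →L[𝕜] 𝕜, IsBasisWithDual q x xs ∧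
    ∃ (r : N ↪ ℕ) (C : ℝ), ∀ (f : E) (A : Finset N) (hA : A.Nonempty),
      IsGreedySet r (fun n => xs n f) A → q (truncation x xs f A hA) ≤ C * q f

/-- The closed linear span of a family. -/
def closedSpan (𝕜 : Type*) {E M : Type*} [RCLike 𝕜] [AddCommGroup E] [Module 𝕜 E]
    [TopologicalSpace E] [IsTopologicalAddGroup E] [ContinuousSMul 𝕜 E] (y : M → E) :
    Submodule 𝕜 E :=
  (Submodule.span 𝕜 (Set.range y)).topologicalClosure

theorem mem_closedSpan (𝕜 : Type*) {E M : Type*} [RCLike 𝕜] [AddCommGroup E] [Module 𝕜 E]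
    [TopologicalSpace E] [IsTopologicalAddGroup E] [ContinuousSMul 𝕜 E] (y : M → E) (i : M) :
    y i ∈ closedSpan 𝕜 y :=
  Submodule.le_topologicalClosure _ (Submodule.subset_span ⟨i, rfl⟩)

/-- `y` is a truncation quasi-greedy basic sequence of `(E, q)`: a truncation quasi-greedy basis of
its closed linear span, equipped with the restriction of `q`. -/
def IsTruncationQuasiGreedyBasicSequence (𝕜 : Type*) {E M : Type*} [RCLike 𝕜] [AddCommGroup E]
    [Module 𝕜 E] [TopologicalSpace E] [IsTopologicalAddGroup E] [ContinuousSMul 𝕜 E]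
    (q : E → ℝ) (y : M → E) : Prop :=
  IsTruncationQuasiGreedyBasis 𝕜 (fun v : closedSpan 𝕜 y => q (v : E))
    (fun i => (⟨y i, mem_closedSpan 𝕜 y i⟩ : closedSpan 𝕜 y))

/-- The lower democracy function `m ↦ inf_{|A| ≥ m} q (∑_{n ∈ A} x n)`. The value is `∞` only if the
family has fewer than `m` members. -/
noncomputable def lowerDemocracy {E N : Type*} [AddCommGroup E] (q : E → ℝ) (x : N → E) (m : ℕ) :
    ℝ≥0∞ :=
  ⨅ (A : Finset N) (_ : m ≤ A.card), ENNReal.ofReal (q (∑ n ∈ A, x n))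

/-- The upper democracy (or fundamental) function `m ↦ sup_{|A| ≤ m} q (∑_{n ∈ A} x n)`. -/
noncomputable def upperDemocracy {E N : Type*} [AddCommGroup E] (q : E → ℝ) (x : N → E) (m : ℕ) :
    ℝ≥0∞ :=
  ⨆ (A : Finset N) (_ : A.card ≤ m), ENNReal.ofReal (q (∑ n ∈ A, x n))

/-- `α m ≲ β m` for `m ∈ S`. -/
def LesssimOn (S : Set ℕ) (α β : ℕ → ℝ≥0∞) : Prop :=
  ∃ C : ℝ≥0, 0 < C ∧ ∀ m ∈ S, α m ≤ C * β m

/-- The sequence `(s m)` for `m ≥ 1` is doubling. -/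
def IsDoubling (s : ℕ → ℝ≥0∞) : Prop :=
  LesssimOn {m | 1 ≤ m} (fun m => s (2 * m)) s

end GreedyBases

/-! Truncation quasi-greediness bounds the `k`-th largest coefficient of `f` by a constant times `q
f / φ_l(k)`. Since `∑ 1/φ_l` converges, coefficients with respect to `x` are absolutely summable,
with small coefficients contributing uniformly little. Hence in the formal expansion `1 = ∑ xs n (y
i) * ys i (P (x n))` some index `n = ν i` has both factors bounded below, and the fibres of `ν` are
uniformly bounded.

The matrix `xs (ν i) (y j)` thus has large diagonal and bounded column sums. Paving splits it into
boundedly many blocks whose diagonals dominate, and on each block some choice of signs makes every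
entry of the image large. The truncation bound then controls the sum of `x` over `ν` of the largest
block by the sum of `y` over the whole set; doubling absorbs the lost proportion and gives the first
inequality.

That inequality transfers the summable lower bound to `y`, so the same argument applies to the
matrix `ys i (P (x (ν j)))`. Adding up all its blocks gives the third inequality. The second only
needs a set with exactly `m` elements. -/

namespace GreedyBases

/-! ### Quasi-norms: bounded operators, density, scalar combinations. -/

section QuasiNorm

variable {𝕜 E F : Type*} [RCLike 𝕜] [AddCommGroup E] [Module 𝕜 E] [TopologicalSpace E]
  [AddCommGroup F] [Module 𝕜 F] [TopologicalSpace F] {q : E → ℝ} {p : F → ℝ}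

theorem IsQuasiNorm.map_zero (hq : IsQuasiNorm 𝕜 q) : q 0 = 0 := (hq.eq_zero_iff 0).2 rfl

/-- Each term costs a factor `κ`, so this is useful only for boundedly many terms (net points,
colour classes) or as a crude a priori bound. -/
theorem IsQuasiNorm.sum_le (hq : IsQuasiNorm 𝕜 q) {κ : ℝ} (hκ : 1 ≤ κ)
    (hadd : ∀ f g, q (f + g) ≤ κ * (q f + q g)) {ι : Type*} (s : Finset ι) (f : ι → E) :
    q (∑ i ∈ s, f i) ≤ κ ^ s.card * ∑ i ∈ s, q (f i) := by
  classical
  induction s using Finset.induction_on with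
  | empty => simp [hq.map_zero]
  | insert a s ha ih =>
    rw [Finset.sum_insert ha, Finset.sum_insert ha, Finset.card_insert_of_notMem ha]
    have h1 : (1 : ℝ) ≤ κ ^ s.card := one_le_pow₀ hκ
    calc q (f a + ∑ i ∈ s, f i) ≤ κ * (q (f a) + q (∑ i ∈ s, f i)) := hadd _ _
      _ ≤ κ * (κ ^ s.card * q (f a) + κ ^ s.card * ∑ i ∈ s, q (f i)) := by
        gcongr
        exact le_mul_of_one_le_left (hq.nonneg _) h1
      _ = _ := by ring

theorem IsQuasiNorm.exists_bound (hq : IsQuasiNorm 𝕜 q) (hp : IsQuasiNorm 𝕜 p) (T : E →L[𝕜] F) :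
    ∃ C : ℝ, 0 < C ∧ ∀ f, p (T f) ≤ C * q f := by
  have h1 : {f | p f < 1} ∈ 𝓝 (T 0) := by
    rw [_root_.map_zero]; exact hp.hasBasis_nhds_zero.mem_of_mem one_pos
  obtain ⟨δ, hδ, hsub⟩ := hq.hasBasis_nhds_zero.mem_iff.1 (T.continuous.continuousAt h1)
  refine ⟨2 / δ, by positivity, fun f => ?_⟩
  rcases (hq.nonneg f).eq_or_lt with h | h
  · have hf : f = 0 := (hq.eq_zero_iff f).1 h.symm
    simp [hf, hq.map_zero, hp.map_zero]
  · have hmem : ((δ / (2 * q f) : ℝ) : 𝕜) • f ∈ {f | q f < δ} := by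
      have : δ / (2 * q f) * q f = δ / 2 := by field_simp
      simp only [Set.mem_ofPred_eq, hq.smul, RCLike.norm_ofReal]
      rw [abs_of_pos (by positivity), this]
      linarith
    have h2 : p (T (((δ / (2 * q f) : ℝ) : 𝕜) • f)) < 1 := hsub hmem
    rw [map_smul, hp.smul, RCLike.norm_ofReal, abs_of_pos (by positivity)] at h2
    have h3 : p (T f) < 1 / (δ / (2 * q f)) := by
      rw [lt_div_iff₀ (by positivity)]; linarith
    calc p (T f) ≤ 1 / (δ / (2 * q f)) := h3.le
      _ = 2 / δ * q f := by field_simp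

theorem IsQuasiNorm.exists_mem_of_dense [IsTopologicalAddGroup E] (hq : IsQuasiNorm 𝕜 q)
    {s : Set E} (hs : Dense s) (f : E) {η : ℝ} (hη : 0 < η) : ∃ g ∈ s, q (f - g) < η := by
  have hc : Filter.Tendsto (fun g => f - g) (𝓝 f) (𝓝 0) := by
    have : Continuous (fun g => f - g) := by fun_prop
    simpa using this.tendsto f
  have hm : {g | q (f - g) < η} ∈ 𝓝 f := hc (hq.hasBasis_nhds_zero.mem_of_mem hη)
  obtain ⟨g, hg, hgs⟩ := mem_closure_iff_nhds.1 (hs f) _ hm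
  exact ⟨g, hgs, hg⟩

theorem IsQuasiNorm.restrict (hq : IsQuasiNorm 𝕜 q) (V : Submodule 𝕜 E) :
    IsQuasiNorm 𝕜 (fun v : V => q (v : E)) where
  nonneg f := hq.nonneg _
  eq_zero_iff f := by simp [hq.eq_zero_iff]
  smul a f := by simp [hq.smul]
  add_le := by
    obtain ⟨κ, h1, h2⟩ := hq.add_le
    exact ⟨κ, h1, fun f g => by simpa using h2 f g⟩
  hasBasis_nhds_zero := by
    rw [nhds_subtype]
    exact hq.hasBasis_nhds_zero.comap _

/-- A finite net of the unit ball of the scalars reduces linear combinations with coefficients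
bounded by one to sums over subsets. -/
theorem IsQuasiNorm.exists_combination_le (hq : IsQuasiNorm 𝕜 q) :
    ∃ C : ℝ, 0 < C ∧ ∀ {ι : Type*} (A : Finset ι) (v : ι → E) (R : ℝ),
      (∀ B ⊆ A, q (∑ n ∈ B, v n) ≤ R) →
      ∀ a : ι → 𝕜, (∀ n ∈ A, ‖a n‖ ≤ 1) → q (∑ n ∈ A, a n • v n) ≤ C * R := by
  classical
  obtain ⟨κ, hκ, hadd⟩ := hq.add_le
  have hκ0 : 0 < κ := by linarith
  -- With radius `1 / (2 * κ)`, the rounding error rescaled by `2 * κ` again has coefficients of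
  -- modulus at most one, and its contribution is at most half the bound at hand.
  obtain ⟨D, hD, hDfin, hcov⟩ := finite_cover_balls_of_compact
    (isCompact_closedBall (0 : 𝕜) 1) (e := 1 / (2 * κ)) (by positivity)
  have hnet : ∀ z : 𝕜, ∃ d : 𝕜, ‖z‖ ≤ 1 → d ∈ D ∧ ‖z - d‖ ≤ 1 / (2 * κ) := by
    intro z
    by_cases hz : ‖z‖ ≤ 1
    · have := hcov (show z ∈ Metric.closedBall 0 1 by simpa using hz)
      simp only [Set.mem_iUnion, Metric.mem_ball, dist_eq_norm] at this
      obtain ⟨d, hd, h⟩ := this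
      exact ⟨d, fun _ => ⟨hd, h.le⟩⟩
    · exact ⟨0, fun h => absurd h hz⟩
  choose d hd using hnet
  set D' := hDfin.toFinset with hD'
  have hD'le : ∀ z ∈ D', ‖z‖ ≤ 1 := fun z hz => by simpa using hD (hDfin.mem_toFinset.1 hz)
  set c : ℝ := κ ^ D'.card * D'.card with hc
  -- `2 * κ * c * R` is the fixed point of `S ↦ κ * c * R + S / 2`; the `+ 1` only secures
  -- positivity.
  refine ⟨2 * κ * c + 1, by positivity, fun {ι} A v R hR a ha => ?_⟩
  have hR0 : 0 ≤ R := by simpa [hq.map_zero] using hR ∅ (by simp)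
  have hquant : ∀ a : ι → 𝕜, (∀ n ∈ A, ‖a n‖ ≤ 1) → q (∑ n ∈ A, d (a n) • v n) ≤ c * R := by
    intro a ha
    have hmaps : ∀ n ∈ A, d (a n) ∈ D' := fun n hn =>
      hDfin.mem_toFinset.2 (hd _ (ha n hn)).1
    rw [← Finset.sum_fiberwise_of_maps_to hmaps]
    refine (hq.sum_le hκ hadd _ _).trans ?_
    rw [hc, mul_assoc]
    gcongr
    rw [← nsmul_eq_mul]
    refine Finset.sum_le_card_nsmul _ _ _ fun z hz => ?_
    have : ∑ n ∈ A with d (a n) = z, d (a n) • v n = z • ∑ n ∈ A with d (a n) = z, v n := by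
      rw [Finset.smul_sum]
      exact Finset.sum_congr rfl fun n hn => by rw [(Finset.mem_filter.1 hn).2]
    rw [this, hq.smul]
    calc ‖z‖ * q (∑ n ∈ A with d (a n) = z, v n) ≤ 1 * R := by
          gcongr
          · exact hq.nonneg _
          · exact hD'le z hz
          · exact hR _ (Finset.filter_subset _ _)
      _ = R := one_mul R
  have hstep : ∀ S : ℝ, (∀ a : ι → 𝕜, (∀ n ∈ A, ‖a n‖ ≤ 1) → q (∑ n ∈ A, a n • v n) ≤ S) →
      ∀ a : ι → 𝕜, (∀ n ∈ A, ‖a n‖ ≤ 1) → q (∑ n ∈ A, a n • v n) ≤ κ * c * R + S / 2 := by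
    intro S hS a ha
    have hsplit : ∑ n ∈ A, a n • v n = ∑ n ∈ A, d (a n) • v n +
        ((1 / (2 * κ) : ℝ) : 𝕜) • ∑ n ∈ A, (((2 * κ : ℝ) : 𝕜) * (a n - d (a n))) • v n := by
      rw [Finset.smul_sum, ← Finset.sum_add_distrib]
      refine Finset.sum_congr rfl fun n _ => ?_
      have h2 : ((1 / (2 * κ) : ℝ) : 𝕜) * ((2 * κ : ℝ) : 𝕜) = 1 := by
        rw [← RCLike.ofReal_mul, one_div_mul_cancel (by positivity), RCLike.ofReal_one]
      rw [smul_smul, ← mul_assoc, h2, one_mul, ← add_smul, add_sub_cancel]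
    have hrem := hS (fun n => ((2 * κ : ℝ) : 𝕜) * (a n - d (a n))) fun n hn => by
      rw [norm_mul, RCLike.norm_ofReal, abs_of_pos (by positivity)]
      calc 2 * κ * ‖a n - d (a n)‖ ≤ 2 * κ * (1 / (2 * κ)) := by
            gcongr
            exact (hd _ (ha n hn)).2
        _ = 1 := by field_simp
    rw [hsplit]
    refine (hadd _ _).trans ?_
    rw [hq.smul, RCLike.norm_ofReal, abs_of_pos (by positivity)]
    calc _ ≤ κ * (c * R + 1 / (2 * κ) * S) := by
          gcongr
          exact hquant a ha
      _ = κ * c * R + S / 2 := by field_simp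
  -- This bound depends on `A`, but it only starts the iteration and disappears in the limit.
  set S₀ : ℝ := κ ^ A.card * ∑ n ∈ A, q (v n) with hS₀
  have hS₀le : ∀ a : ι → 𝕜, (∀ n ∈ A, ‖a n‖ ≤ 1) → q (∑ n ∈ A, a n • v n) ≤ S₀ := by
    intro a ha
    refine (hq.sum_le hκ hadd _ _).trans ?_
    rw [hS₀]
    gcongr with n hn
    rw [hq.smul]
    exact mul_le_of_le_one_left (hq.nonneg _) (ha n hn)
  have hiter : ∀ k : ℕ, ∀ a : ι → 𝕜, (∀ n ∈ A, ‖a n‖ ≤ 1) →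
      q (∑ n ∈ A, a n • v n) ≤ 2 * κ * c * R + (1 / 2) ^ k * S₀ := by
    intro k
    induction k with
    | zero =>
      intro a ha
      have := hS₀le a ha
      have : 0 ≤ 2 * κ * c * R := by positivity
      simp only [pow_zero, one_mul]
      linarith
    | succ k ih =>
      intro a ha
      refine (hstep _ ih a ha).trans (le_of_eq ?_)
      ring
  have hlim : Filter.Tendsto (fun k : ℕ => 2 * κ * c * R + (1 / 2 : ℝ) ^ k * S₀) Filter.atTop
      (𝓝 (2 * κ * c * R + 0 * S₀)) :=
    ((tendsto_pow_atTop_nhds_zero_of_lt_one (by norm_num) (by norm_num)).mul_const _).const_add _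
  have := ge_of_tendsto' hlim fun k => hiter k a ha
  linarith

end QuasiNorm

/-- All coefficients of `f` on the finite set `B` being at least `t` bounds `t` times every
combination of the vectors in `B` with coefficients in the unit ball. -/
def HasTruncationBound {𝕜 E N : Type*} [RCLike 𝕜] [AddCommGroup E] [Module 𝕜 E]
    [TopologicalSpace E] (q : E → ℝ) (x : N → E) (xs : N → E →L[𝕜] 𝕜) (C : ℝ) : Prop :=
  ∀ (f : E) (B : Finset N) (t : ℝ) (a : N → 𝕜), 0 ≤ t → (∀ n ∈ B, t ≤ ‖xs n f‖) →
    (∀ n ∈ B, ‖a n‖ ≤ 1) → t * q (∑ n ∈ B, a n • x n) ≤ C * q f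

/-! ### From greedy sets to arbitrary sets of large coefficients. -/

section Truncation

variable {𝕜 E N : Type*} [RCLike 𝕜] [AddCommGroup E] [Module 𝕜 E] [TopologicalSpace E]
  {q : E → ℝ} {x : N → E} {xs : N → E →L[𝕜] 𝕜}

theorem IsBasisWithDual.apply_sum [DecidableEq N] (h : IsBasisWithDual q x xs) (A : Finset N)
    (a : N → 𝕜) (n : N) : xs n (∑ k ∈ A, a k • x k) = if n ∈ A then a n else 0 := by
  rw [map_sum, ← Finset.sum_ite_eq A n a]
  refine Finset.sum_congr rfl fun k _ => ?_
  rw [map_smul, smul_eq_mul]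
  split_ifs with hnk
  · rw [hnk, h.apply_self, mul_one]
  · rw [h.apply_ne n k hnk, mul_zero]

theorem norm_sgn (a : 𝕜) : ‖sgn a‖ = 1 := by
  unfold sgn
  split_ifs with h
  · simp
  · rw [norm_div, RCLike.norm_ofReal, abs_of_nonneg (norm_nonneg a), div_self (norm_ne_zero_iff.2 h)]

theorem sgn_ofReal_mul {s : ℝ} (hs : 0 < s) {a : 𝕜} (ha : ‖a‖ = 1) : sgn ((s : 𝕜) * a) = a := by
  have ha0 : a ≠ 0 := norm_ne_zero_iff.1 (by rw [ha]; exact one_ne_zero)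
  have hs0 : (s : 𝕜) ≠ 0 := RCLike.ofReal_ne_zero.2 hs.ne'
  unfold sgn
  rw [if_neg (mul_ne_zero hs0 ha0), norm_mul, ha, RCLike.norm_ofReal, abs_of_pos hs, mul_one,
    mul_div_cancel_left₀ _ hs0]

/-- Enlarging the coefficients on `B` by a factor `1 + s` makes `B` a greedy set without ties. The
truncation bound then controls the sum over `B`, and `s` is so small that the perturbation is
absorbed on the left. -/
theorem IsQuasiNorm.exists_subset_sum_le (hq : IsQuasiNorm 𝕜 q) (h : IsBasisWithDual q x xs)
    {r : N ↪ ℕ} {C : ℝ} (hT : ∀ (f : E) (A : Finset N) (hA : A.Nonempty),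
      IsGreedySet r (fun n => xs n f) A → q (truncation x xs f A hA) ≤ C * q f) :
    ∃ D : ℝ, 0 < D ∧ ∀ (A B : Finset N) (ε : N → 𝕜), (∀ n, ‖ε n‖ = 1) → B ⊆ A →
      q (∑ n ∈ B, ε n • x n) ≤ D * q (∑ n ∈ A, ε n • x n) := by
  classical
  obtain ⟨κ, hκ, hadd⟩ := hq.add_le
  have hC0 : 0 < max C 1 := lt_of_lt_of_le one_pos (le_max_right _ _)
  set D := max C 1 * κ with hD
  have hD0 : 0 < D := by positivity
  refine ⟨2 * D, by positivity, fun A B ε hε hBA => ?_⟩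
  rcases B.eq_empty_or_nonempty with rfl | hB
  · simp only [Finset.sum_empty, hq.map_zero]
    have := hq.nonneg (∑ n ∈ A, ε n • x n)
    positivity
  set s : ℝ := 1 / (2 * D) with hs
  have hs0 : 0 < s := by positivity
  set b : N → 𝕜 := fun n => if n ∈ B then ((1 + s : ℝ) : 𝕜) * ε n else ε n with hb
  have hcoef : ∀ n, xs n (∑ k ∈ A, b k • x k) = if n ∈ A then b n else 0 := h.apply_sum A b
  have hcoefB : ∀ n ∈ B, xs n (∑ k ∈ A, b k • x k) = ((1 + s : ℝ) : 𝕜) * ε n := fun n hn => by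
    rw [hcoef, if_pos (hBA hn), hb]; exact if_pos hn
  have hnormB : ∀ n ∈ B, ‖xs n (∑ k ∈ A, b k • x k)‖ = 1 + s := fun n hn => by
    rw [hcoefB n hn, norm_mul, hε, RCLike.norm_ofReal, abs_of_pos (by positivity), mul_one]
  have hgreedy : IsGreedySet r (fun n => xs n (∑ k ∈ A, b k • x k)) B := by
    intro i hi j hj
    left
    show ‖xs j (∑ k ∈ A, b k • x k)‖ < ‖xs i (∑ k ∈ A, b k • x k)‖
    rw [hnormB i hi, hcoef]
    split_ifs
    · rw [hb]; simp only [if_neg hj, hε]; linarith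
    · simp only [norm_zero]; linarith
  have key := hT _ B hB hgreedy
  have htr : truncation x xs (∑ k ∈ A, b k • x k) B hB
      = ((1 + s : ℝ) : 𝕜) • ∑ n ∈ B, ε n • x n := by
    unfold truncation
    congr 1
    · congr 1
      rw [Finset.inf'_congr hB rfl hnormB, Finset.inf'_const]
    · exact Finset.sum_congr rfl fun n hn => by
        rw [hcoefB n hn, sgn_ofReal_mul (by positivity) (hε n)]
  have hsplit : ∑ k ∈ A, b k • x k = ∑ n ∈ A, ε n • x n + (s : 𝕜) • ∑ n ∈ B, ε n • x n := by
    rw [Finset.smul_sum, ← Finset.inter_eq_right.2 hBA, ← Finset.sum_ite_mem,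
      ← Finset.sum_add_distrib]
    refine Finset.sum_congr rfl fun n _ => ?_
    rw [hb]
    dsimp only
    split_ifs
    · rw [RCLike.ofReal_add, RCLike.ofReal_one, add_mul, one_mul, add_smul, mul_smul]
    · rw [add_zero]
  rw [htr, hsplit, hq.smul, RCLike.norm_ofReal, abs_of_pos (by positivity)] at key
  set X := q (∑ n ∈ B, ε n • x n)
  set Y := q (∑ n ∈ A, ε n • x n)
  have hX : 0 ≤ X := hq.nonneg _
  have hY : 0 ≤ Y := hq.nonneg _
  have h1 : (1 + s) * X ≤ D * (Y + s * X) := by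
    refine key.trans ?_
    rw [hD, mul_assoc]
    refine mul_le_mul (le_max_left _ _) ?_ (hq.nonneg _) hC0.le
    refine (hadd _ _).trans_eq ?_
    rw [hq.smul, RCLike.norm_ofReal, abs_of_pos hs0]
  have h2 : D * s = 1 / 2 := by rw [hs]; field_simp
  have h3 : 0 ≤ s * X := by positivity
  have h4 : D * (Y + s * X) = D * Y + 1 / 2 * X := by rw [← h2]; ring
  linarith

/-- The set `A` of all indices with coefficient at least `t` is greedy and contains `B`. Truncating
on `A`, passing to subsets of `B`, and then allowing arbitrary coefficients in the unit ball removes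
every reference to greedy sets. -/
theorem IsTruncationQuasiGreedyBasis.exists_hasTruncationBound [IsTopologicalAddGroup E]
    (hq : IsQuasiNorm 𝕜 q) (hx : IsTruncationQuasiGreedyBasis 𝕜 q x) :
    ∃ xs : N → E →L[𝕜] 𝕜, IsBasisWithDual q x xs ∧ ∃ C : ℝ, 0 < C ∧
      HasTruncationBound q x xs C := by
  classical
  obtain ⟨xs, h, r, C, hT⟩ := hx
  refine ⟨xs, h, ?_⟩
  obtain ⟨D, hD, hsub⟩ := hq.exists_subset_sum_le h hT
  obtain ⟨K, hK, hcomb⟩ := hq.exists_combination_le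
  obtain ⟨M, hM⟩ := h.dual_bounded
  have hC0 : 0 < max C 1 := lt_of_lt_of_le one_pos (le_max_right _ _)
  refine ⟨K * (D * max C 1), by positivity, fun f B t a ht htB ha => ?_⟩
  rcases ht.eq_or_lt with rfl | ht
  · rw [zero_mul]
    have := hq.nonneg f
    positivity
  rcases B.eq_empty_or_nonempty with rfl | hB
  · simp only [Finset.sum_empty, hq.map_zero, mul_zero]
    have := hq.nonneg f
    positivity
  -- An approximant of `f` in the span has finite support, and off that support the coefficients of
  -- `f` are below `t`.
  have hfin : {n | t ≤ ‖xs n f‖}.Finite := by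
    have hM0 : 0 < max M 1 := lt_of_lt_of_le one_pos (le_max_right _ _)
    obtain ⟨g, hg, hfg⟩ := hq.exists_mem_of_dense h.dense_span f (η := t / max M 1) (by positivity)
    obtain ⟨c, rfl⟩ := (Finsupp.mem_span_range_iff_exists_finsupp).1 hg
    refine c.support.finite_toSet.subset fun n hn => ?_
    by_contra hnc
    have h0 : xs n (c.sum fun i a => a • x i) = 0 := by
      rw [Finsupp.sum, h.apply_sum, if_neg (Finset.mem_coe.not.1 hnc)]
    have h1 : ‖xs n f‖ < t := by
      calc ‖xs n f‖ = ‖xs n (f - c.sum fun i a => a • x i)‖ := by rw [map_sub, h0, sub_zero]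
        _ ≤ max M 1 * q (f - c.sum fun i a => a • x i) :=
          (hM n _).trans (mul_le_mul_of_nonneg_right (le_max_left _ _) (hq.nonneg _))
        _ < max M 1 * (t / max M 1) := by gcongr
        _ = t := by field_simp
    exact absurd hn (not_le.2 h1)
  set A := hfin.toFinset with hA
  have hmemA : ∀ n, n ∈ A ↔ t ≤ ‖xs n f‖ := fun n => hfin.mem_toFinset
  have hBA : B ⊆ A := fun n hn => (hmemA n).2 (htB n hn)
  have hAne : A.Nonempty := hB.mono hBA
  have hgreedy : IsGreedySet r (fun n => xs n f) A := fun i hi j hj =>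
    Or.inl ((not_le.1 fun hj' => hj ((hmemA j).2 hj')).trans_le ((hmemA i).1 hi))
  have key := hT f A hAne hgreedy
  unfold truncation at key
  rw [hq.smul, RCLike.norm_ofReal] at key
  have htinf : t ≤ |A.inf' hAne fun n => ‖xs n f‖| :=
    ((Finset.le_inf'_iff hAne _).2 fun n hn => (hmemA n).1 hn).trans (le_abs_self _)
  have hA2 : t * q (∑ n ∈ A, sgn (xs n f) • x n) ≤ max C 1 * q f :=
    (mul_le_mul_of_nonneg_right htinf (hq.nonneg _)).trans
      (key.trans (mul_le_mul_of_nonneg_right (le_max_left _ _) (hq.nonneg _)))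
  have hB2 := hcomb B (fun n => sgn (xs n f) • x n) (D * q (∑ n ∈ A, sgn (xs n f) • x n))
    (fun B' hB' => hsub A B' (fun n => sgn (xs n f)) (fun n => norm_sgn _) (hB'.trans hBA))
    (fun n => a n * (sgn (xs n f))⁻¹) fun n hn => by
      rw [norm_mul, norm_inv, norm_sgn, inv_one, mul_one]; exact ha n hn
  have hcongr : ∑ n ∈ B, (a n * (sgn (xs n f))⁻¹) • sgn (xs n f) • x n = ∑ n ∈ B, a n • x n := by
    refine Finset.sum_congr rfl fun n _ => ?_
    have h0 : sgn (xs n f) ≠ 0 := norm_ne_zero_iff.1 (by rw [norm_sgn]; exact one_ne_zero)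
    rw [smul_smul, inv_mul_cancel_right₀ h0]
  rw [hcongr] at hB2
  calc t * q (∑ n ∈ B, a n • x n) ≤ t * (K * (D * q (∑ n ∈ A, sgn (xs n f) • x n))) := by gcongr
    _ = K * D * (t * q (∑ n ∈ A, sgn (xs n f) • x n)) := by ring
    _ ≤ K * D * (max C 1 * q f) := by gcongr
    _ = _ := by ring

end Truncation

/-! ### Rearrangements, paving of matrices and choice of signs. -/

section Combinatorics

/-- If every nonempty subset of `F` of size `k` has an element at which `u` is at most `b k`, then
the sum of `u` over `F` is at most `b 1 + ⋯ + b |F|`. -/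
theorem sum_le_sum_range_of_exists_le {N : Type*} (u : N → ℝ) (b : ℕ → ℝ) (F : Finset N)
    (h : ∀ G ⊆ F, G.Nonempty → ∃ n ∈ G, u n ≤ b G.card) :
    ∑ n ∈ F, u n ≤ ∑ k ∈ Finset.range F.card, b (k + 1) := by
  classical
  induction hk : F.card generalizing F with
  | zero => simp [Finset.card_eq_zero.1 hk]
  | succ k ih =>
    obtain ⟨n, hn, hle⟩ := h F subset_rfl (Finset.card_pos.1 (by omega))
    rw [← Finset.sum_erase_add F u hn, Finset.sum_range_succ]
    rw [hk] at hle
    refine add_le_add (ih (F.erase n) (fun G hG => h G (hG.trans (Finset.erase_subset _ _))) ?_) hle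
    rw [Finset.card_erase_of_mem hn, hk, Nat.add_sub_cancel]

/-- Colouring the points in increasing order, each receives the colour that carries the least
weight among its predecessors. -/
theorem exists_coloring_sum_lt_le {ι α : Type*} [LinearOrder α] (r : ι → α)
    (w : ι → ι → ℝ) (hw : ∀ i j, 0 ≤ w i j) {k : ℕ} (hk : 0 < k) (A : Finset ι) :
    ∃ c : ι → Fin k, ∀ j ∈ A,
      k * ∑ i ∈ A with r i < r j ∧ c i = c j, w i j ≤ ∑ i ∈ A, w i j := by
  classical
  induction A using Finset.induction_on_max_value r with
  | empty => exact ⟨fun _ => ⟨0, hk⟩, by simp⟩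
  | insert a s ha hmax ih =>
    obtain ⟨c, hc⟩ := ih
    have : Nonempty (Fin k) := ⟨⟨0, hk⟩⟩
    -- The lightest of the `k` colours carries at most the average, a `1 / k` share of the weight.
    obtain ⟨z, -, hz⟩ := Finset.exists_min_image Finset.univ
      (fun z : Fin k => ∑ i ∈ s with c i = z, w i a) Finset.univ_nonempty
    have hcs : ∀ i ∈ s, Function.update c a z i = c i := fun i hi =>
      Function.update_of_ne (ne_of_mem_of_not_mem hi ha) _ _
    refine ⟨Function.update c a z, fun j hj => ?_⟩
    rcases Finset.mem_insert.1 hj with rfl | hjs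
    · have h1 : ∑ i ∈ insert j s with r i < r j ∧
          Function.update c j z i = Function.update c j z j, w i j
          ≤ ∑ i ∈ s with c i = z, w i j := by
        refine Finset.sum_le_sum_of_subset_of_nonneg (fun i hi => ?_) fun i _ _ => hw i j
        obtain ⟨hi1, hi2, hi3⟩ := Finset.mem_filter.1 hi
        have his : i ∈ s := by
          rcases Finset.mem_insert.1 hi1 with rfl | h
          · exact absurd hi2 (lt_irrefl _)
          · exact h
        rw [hcs i his, Function.update_self] at hi3
        exact Finset.mem_filter.2 ⟨his, hi3⟩
      have h2 : (k : ℝ) * ∑ i ∈ s with c i = z, w i j ≤ ∑ i ∈ s, w i j := by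
        rw [← Finset.sum_fiberwise s c (fun i => w i j)]
        have := Finset.card_nsmul_le_sum Finset.univ
          (fun z => ∑ i ∈ s with c i = z, w i j) _ (fun z' hz' => hz z' hz')
        rwa [Finset.card_univ, Fintype.card_fin, nsmul_eq_mul] at this
      calc _ ≤ (k : ℝ) * ∑ i ∈ s with c i = z, w i j := by gcongr
        _ ≤ ∑ i ∈ s, w i j := h2
        _ ≤ _ := Finset.sum_le_sum_of_subset_of_nonneg (Finset.subset_insert _ _)
            fun i _ _ => hw i j
    · have h1 : (insert a s).filter (fun i => r i < r j ∧
          Function.update c a z i = Function.update c a z j)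
          = s.filter (fun i => r i < r j ∧ c i = c j) := by
        ext i
        simp only [Finset.mem_filter, Finset.mem_insert]
        rw [hcs j hjs]
        constructor
        · rintro ⟨rfl | hi, h2, h3⟩
          · exact absurd h2 (not_lt.2 (hmax j hjs))
          · exact ⟨hi, h2, by rwa [hcs i hi] at h3⟩
        · rintro ⟨hi, h2, h3⟩
          exact ⟨Or.inr hi, h2, by rwa [hcs i hi]⟩
      rw [h1]
      exact (hc j hjs).trans (Finset.sum_le_sum_of_subset_of_nonneg (Finset.subset_insert _ _)
        fun i _ _ => hw i j)

/-- Paving of a nonnegative matrix with bounded column sums. -/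
theorem exists_coloring_sum_ne_le {ι : Type*} [Fintype ι] [DecidableEq ι]
    (w : ι → ι → ℝ) (hw : ∀ i j, 0 ≤ w i j) {k : ℕ} (hk : 0 < k) :
    ∃ c : ι → Fin k × Fin k, ∀ j,
      k * ∑ i with i ≠ j ∧ c i = c j, w i j ≤ 2 * ∑ i, w i j := by
  -- Any `i ≠ j` precedes `j` either in an order or in its reverse, so colouring for both and
  -- pairing the colours handles all off-diagonal entries.
  obtain ⟨c₁, h₁⟩ := exists_coloring_sum_lt_le (Fintype.equivFin ι) w hw hk Finset.univ
  obtain ⟨c₂, h₂⟩ := exists_coloring_sum_lt_le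
    (fun i => OrderDual.toDual (Fintype.equivFin ι i)) w hw hk Finset.univ
  refine ⟨fun i => (c₁ i, c₂ i), fun j => ?_⟩
  have hle : ∑ i with i ≠ j ∧ (c₁ i, c₂ i) = (c₁ j, c₂ j), w i j ≤
      ∑ i with Fintype.equivFin ι i < Fintype.equivFin ι j ∧ c₁ i = c₁ j, w i j +
      ∑ i with OrderDual.toDual (Fintype.equivFin ι i) < OrderDual.toDual (Fintype.equivFin ι j) ∧
        c₂ i = c₂ j, w i j := by
    rw [← Finset.sum_union_inter]
    refine le_trans (Finset.sum_le_sum_of_subset_of_nonneg (fun i hi => ?_)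
      fun i _ _ => hw i j) (le_add_of_nonneg_right (Finset.sum_nonneg fun i _ => hw i j))
    obtain ⟨-, hne, hc⟩ := Finset.mem_filter.1 hi
    rw [Prod.mk.injEq] at hc
    have hne' : Fintype.equivFin ι i ≠ Fintype.equivFin ι j := fun h =>
      hne ((Fintype.equivFin ι).injective h)
    rcases lt_or_gt_of_ne hne' with hlt | hgt
    · exact Finset.mem_union_left _ (Finset.mem_filter.2 ⟨Finset.mem_univ _, hlt, hc.1⟩)
    · exact Finset.mem_union_right _
        (Finset.mem_filter.2 ⟨Finset.mem_univ _, OrderDual.toDual_lt_toDual.2 hgt, hc.2⟩)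
  refine (mul_le_mul_of_nonneg_left hle (Nat.cast_nonneg k)).trans ?_
  rw [mul_add, two_mul (∑ i, w i j)]
  exact add_le_add (h₁ j (Finset.mem_univ _)) (h₂ j (Finset.mem_univ _))

/-- A matrix whose diagonal dominates its columns maps some vector of signs to a vector all of whose
entries are large. -/
theorem exists_signs_le_norm_sum {𝕜 ι : Type*} [RCLike 𝕜] [Fintype ι] [DecidableEq ι]
    (T : ι → ι → 𝕜) {δ : ℝ} (hdiag : ∀ i, δ ≤ ‖T i i‖)
    (hcol : ∀ j, ∑ i with i ≠ j, ‖T i j‖ ≤ δ / 2) :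
    ∃ ε : ι → 𝕜, (∀ j, ‖ε j‖ = 1) ∧ ∀ i, δ / 2 ≤ ‖∑ j, T i j * ε j‖ := by
  -- For signs maximising the `ℓ¹` norm of the image, flipping the sign at `j` gains at least `2 * δ
  -- - 2 * ‖ρ j‖` in entry `j` and loses at most `δ` elsewhere; so `‖ρ j‖ ≥ δ / 2`.
  obtain ⟨e, he⟩ := Finite.exists_max fun e : ι → ℤˣ => ∑ i, ‖∑ j, T i j * ((e j : ℤ) : 𝕜)‖
  have hnorm : ∀ u : ℤˣ, ‖((u : ℤ) : 𝕜)‖ = 1 := fun u => by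
    rcases Int.units_eq_one_or u with rfl | rfl <;> simp
  refine ⟨fun j => ((e j : ℤ) : 𝕜), fun j => hnorm _, fun j => ?_⟩
  set ρ : ι → 𝕜 := fun i => ∑ l, T i l * ((e l : ℤ) : 𝕜) with hρ
  show δ / 2 ≤ ‖ρ j‖
  have hflip : ∀ i, ∑ l, T i l * ((Function.update e j (-e j) l : ℤ) : 𝕜)
      = ρ i - 2 * (T i j * ((e j : ℤ) : 𝕜)) := by
    intro i
    rw [hρ]
    dsimp only
    rw [← Finset.add_sum_erase _ _ (Finset.mem_univ j),
      ← Finset.add_sum_erase _ (fun l => T i l * ((e l : ℤ) : 𝕜)) (Finset.mem_univ j),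
      Function.update_self]
    have : ∑ l ∈ Finset.univ.erase j, T i l * ((Function.update e j (-e j) l : ℤ) : 𝕜)
        = ∑ l ∈ Finset.univ.erase j, T i l * ((e l : ℤ) : 𝕜) :=
      Finset.sum_congr rfl fun l hl => by rw [Function.update_of_ne (Finset.ne_of_mem_erase hl)]
    rw [this]
    push_cast
    ring
  have hmax := he (Function.update e j (-e j))
  simp only [hflip] at hmax
  rw [← Finset.add_sum_erase _ _ (Finset.mem_univ j),
    ← Finset.add_sum_erase _ (fun i => ‖∑ l, T i l * ((e l : ℤ) : 𝕜)‖) (Finset.mem_univ j)] at hmax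
  have hoff : ∀ i, ‖ρ i‖ - 2 * ‖T i j‖ ≤ ‖ρ i - 2 * (T i j * ((e j : ℤ) : 𝕜))‖ := fun i => by
    have := norm_sub_norm_le (ρ i) (2 * (T i j * ((e j : ℤ) : 𝕜)))
    rwa [norm_mul, norm_mul, hnorm, mul_one, RCLike.norm_two] at this
  have hon : 2 * ‖T j j‖ - ‖ρ j‖ ≤ ‖ρ j - 2 * (T j j * ((e j : ℤ) : 𝕜))‖ := by
    have := norm_sub_norm_le (2 * (T j j * ((e j : ℤ) : 𝕜))) (ρ j)
    rwa [norm_mul, norm_mul, hnorm, mul_one, RCLike.norm_two, norm_sub_rev] at this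
  have hsum : ∑ i ∈ Finset.univ.erase j, ‖ρ i‖ - 2 * ∑ i ∈ Finset.univ.erase j, ‖T i j‖
      ≤ ∑ i ∈ Finset.univ.erase j, ‖ρ i - 2 * (T i j * ((e j : ℤ) : 𝕜))‖ := by
    rw [Finset.mul_sum, ← Finset.sum_sub_distrib]
    exact Finset.sum_le_sum fun i _ => hoff i
  have hcolj := hcol j
  rw [Finset.filter_ne'] at hcolj
  have hd := hdiag j
  have hmax' : ‖ρ j - 2 * (T j j * ((e j : ℤ) : 𝕜))‖ +
      ∑ i ∈ Finset.univ.erase j, ‖ρ i - 2 * (T i j * ((e j : ℤ) : 𝕜))‖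
      ≤ ‖ρ j‖ + ∑ i ∈ Finset.univ.erase j, ‖ρ i‖ := hmax
  linarith

/-- A matrix with bounded column sums and large diagonal splits into boundedly many blocks, each
of which maps some vector of signs to a vector all of whose entries are large. -/
theorem exists_coloring_signs {𝕜 M : Type*} [RCLike 𝕜] {δ W : ℝ} {k : ℕ} (hk : 0 < k)
    (hkW : 4 * W ≤ k * δ) (T : M → M → 𝕜) (A : Finset M) (hdiag : ∀ i ∈ A, δ ≤ ‖T i i‖)
    (hcol : ∀ j ∈ A, ∑ i ∈ A, ‖T i j‖ ≤ W) :
    ∃ c : M → Fin k × Fin k, ∀ z, ∃ ε : M → 𝕜, (∀ j, ‖ε j‖ = 1) ∧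
      ∀ i ∈ A, c i = z → δ / 2 ≤ ‖∑ j ∈ A with c j = z, T i j * ε j‖ := by
  classical
  obtain ⟨c, hc⟩ := exists_coloring_sum_ne_le (fun i j : A => ‖T i j‖) (fun _ _ => norm_nonneg _) hk
  set c' : M → Fin k × Fin k := fun i => if h : i ∈ A then c ⟨i, h⟩ else (⟨0, hk⟩, ⟨0, hk⟩)
  have hc' : ∀ i : A, c' i = c i := fun i => dif_pos i.2
  refine ⟨c', fun z => ?_⟩
  set Z := A.filter fun j => c' j = z with hZ
  have hZA : ∀ i : Z, (i : M) ∈ A := fun i => (Finset.mem_filter.1 i.2).1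
  obtain ⟨ε, hε, hlarge⟩ := exists_signs_le_norm_sum (δ := δ) (fun i j : Z => T i j)
    (fun i => hdiag i (hZA i)) fun j => by
      have h1 := hc ⟨j, hZA j⟩
      rw [Finset.sum_coe_sort A (fun i => ‖T i j‖)] at h1
      have h2 : ∑ i : Z with i ≠ j, ‖T i j‖
          ≤ ∑ i : A with i ≠ ⟨j, hZA j⟩ ∧ c i = c ⟨j, hZA j⟩, ‖T i j‖ := by
        rw [← Finset.sum_image (s := Finset.univ.filter fun i : Z => i ≠ j)
          (g := fun i : Z => (⟨i, hZA i⟩ : A)) (f := fun i : A => ‖T i j‖)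
          (fun a _ b _ h => Subtype.ext (congrArg (fun i : A => (i : M)) h))]
        refine Finset.sum_le_sum_of_subset_of_nonneg (fun i hi => ?_) fun _ _ _ => norm_nonneg _
        obtain ⟨i', hi', rfl⟩ := Finset.mem_image.1 hi
        refine Finset.mem_filter.2 ⟨Finset.mem_univ _, fun h => ?_, ?_⟩
        · exact (Finset.mem_filter.1 hi').2 (Subtype.ext (congrArg (fun i : A => (i : M)) h))
        · rw [← hc', ← hc']
          exact (Finset.mem_filter.1 i'.2).2.trans (Finset.mem_filter.1 j.2).2.symm
      have h3 := hcol j (hZA j)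
      have hk' : (0 : ℝ) < k := Nat.cast_pos.2 hk
      -- The paving leaves at most `2 * W / k`, which is at most `δ / 2` by `hkW`.
      refine h2.trans (le_of_mul_le_mul_left (h1.trans ?_) hk')
      linarith
  refine ⟨fun j => if h : j ∈ Z then ε ⟨j, h⟩ else 1, fun j => ?_, fun i hi hiz => ?_⟩
  · dsimp only
    split_ifs
    · exact hε _
    · exact norm_one
  · have hiZ : i ∈ Z := Finset.mem_filter.2 ⟨hi, hiz⟩
    refine (hlarge ⟨i, hiZ⟩).trans_eq ?_
    rw [← Finset.sum_coe_sort Z]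
    congr 1
    refine Finset.sum_congr rfl fun j _ => ?_
    dsimp only
    rw [dif_pos j.2]

end Combinatorics

/-! ### Summability of coefficients and a common large index. -/

section Coefficients

variable {𝕜 E N : Type*} [RCLike 𝕜] [AddCommGroup E] [Module 𝕜 E] [TopologicalSpace E]
  {q : E → ℝ} {x : N → E} {xs : N → E →L[𝕜] 𝕜} {C : ℝ} {s : ℕ → ℝ}

/-- The norms of sums of `m` members of the family `x` are at least `1 / s m`. -/
def SumLowerBound (q : E → ℝ) (x : N → E) (s : ℕ → ℝ) : Prop :=
  ∀ F : Finset N, F.Nonempty → 1 ≤ s F.card * q (∑ n ∈ F, x n)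

theorem HasTruncationBound.mul_sum_le (hT : HasTruncationBound q x xs C) {f : E} {B : Finset N}
    {t : ℝ} (ht : 0 ≤ t) (hB : ∀ n ∈ B, t ≤ ‖xs n f‖) : t * q (∑ n ∈ B, x n) ≤ C * q f := by
  simpa using hT f B t (fun _ => 1) ht hB (fun _ _ => by simp)

theorem HasTruncationBound.combination_le (hT : HasTruncationBound q x xs C)
    (h : IsBasisWithDual q x xs) {A B : Finset N} (hBA : B ⊆ A) {a : N → 𝕜}
    (ha : ∀ n ∈ B, ‖a n‖ ≤ 1) : q (∑ n ∈ B, a n • x n) ≤ C * q (∑ n ∈ A, x n) := by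
  classical
  have := hT (∑ n ∈ A, (1 : 𝕜) • x n) B 1 a zero_le_one (fun n hn => by
    rw [h.apply_sum A (fun _ => 1), if_pos (hBA hn), norm_one]) ha
  simpa using this

/-- The smallest coefficient on `F` times the sum over `F` is a truncation of `f`, while `s F.card`
bounds the inverse norm of that sum. -/
theorem HasTruncationBound.exists_coeff_le (hT : HasTruncationBound q x xs C)
    (hs0 : ∀ k, 0 ≤ s k) (hs : SumLowerBound q x s) (f : E) {F : Finset N} (hF : F.Nonempty) :
    ∃ n ∈ F, ‖xs n f‖ ≤ C * q f * s F.card := by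
  obtain ⟨n, hn, hmin⟩ := Finset.exists_min_image F (fun n => ‖xs n f‖) hF
  refine ⟨n, hn, ?_⟩
  have h1 := hT.mul_sum_le (norm_nonneg (xs n f)) hmin
  calc ‖xs n f‖ ≤ ‖xs n f‖ * (s F.card * q (∑ n ∈ F, x n)) :=
        le_mul_of_one_le_right (norm_nonneg _) (hs F hF)
    _ = ‖xs n f‖ * q (∑ n ∈ F, x n) * s F.card := by ring
    _ ≤ C * q f * s F.card := mul_le_mul_of_nonneg_right h1 (hs0 _)

theorem HasTruncationBound.sum_coeff_le (hT : HasTruncationBound q x xs C) (hC : 0 < C)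
    (hq : IsQuasiNorm 𝕜 q)
    (hs0 : ∀ k, 0 ≤ s k) (hsum : Summable fun k => s (k + 1)) (hs : SumLowerBound q x s) (f : E)
    (F : Finset N) : ∑ n ∈ F, ‖xs n f‖ ≤ C * (∑' k, s (k + 1)) * q f := by
  have h0 := hq.nonneg f
  calc ∑ n ∈ F, ‖xs n f‖ ≤ ∑ k ∈ Finset.range F.card, C * q f * s (k + 1) :=
        sum_le_sum_range_of_exists_le _ (fun k => C * q f * s k) F
          fun G _ hG => hT.exists_coeff_le hs0 hs f hG
    _ = C * q f * ∑ k ∈ Finset.range F.card, s (k + 1) := by rw [Finset.mul_sum]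
    _ ≤ C * q f * ∑' k, s (k + 1) := by
        gcongr
        exact hsum.sum_le_tsum _ fun k _ => hs0 _
    _ = _ := by ring

/-- Small coefficients of the vectors of a bounded set have uniformly small sums. -/
theorem HasTruncationBound.exists_sum_coeff_le (hT : HasTruncationBound q x xs C) (hC : 0 < C)
    (hs0 : ∀ k, 0 ≤ s k) (hsum : Summable fun k => s (k + 1)) (hs : SumLowerBound q x s)
    {R η : ℝ} (hR : 0 ≤ R) (hη : 0 < η) :
    ∃ t : ℝ, 0 < t ∧ ∀ (f : E) (F : Finset N), q f ≤ R → (∀ n ∈ F, ‖xs n f‖ ≤ t) →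
      ∑ n ∈ F, ‖xs n f‖ ≤ η := by
  -- The `K` largest coefficients are controlled by `t`, the others by the tail of the series; each
  -- part receives half of `η`.
  have htail : Filter.Tendsto (fun K => C * R * ∑' k, s (k + K + 1)) Filter.atTop (𝓝 (C * R * 0)) :=
    (tendsto_sum_nat_add fun k => s (k + 1)).const_mul _
  rw [mul_zero] at htail
  obtain ⟨K, hK⟩ := (htail.eventually (gt_mem_nhds (half_pos hη))).exists
  refine ⟨η / (2 * (K + 1)), by positivity, fun f F hf hF => ?_⟩
  set t := η / (2 * (K + 1)) with ht
  have ht0 : 0 < t := by positivity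
  have hKt : K * t ≤ η / 2 := by
    rw [ht]
    calc (K : ℝ) * (η / (2 * (K + 1))) ≤ (K + 1) * (η / (2 * (K + 1))) := by gcongr; linarith
      _ = η / 2 := by field_simp
  have hb0 : ∀ k, 0 ≤ min t (C * R * s k) := fun k => le_min ht0.le (by have := hs0 k; positivity)
  have hsumK : Summable fun k => s (k + K + 1) := (summable_nat_add_iff K).2 hsum
  calc ∑ n ∈ F, ‖xs n f‖ ≤ ∑ k ∈ Finset.range F.card, min t (C * R * s (k + 1)) := by
        refine sum_le_sum_range_of_exists_le _ (fun k => min t (C * R * s k)) F fun G hG hGne => ?_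
        obtain ⟨n, hn, hle⟩ := hT.exists_coeff_le hs0 hs f hGne
        refine ⟨n, hn, le_min (hF n (hG hn)) (hle.trans ?_)⟩
        have := hs0 G.card
        gcongr
    _ ≤ ∑ k ∈ Finset.range (K + F.card), min t (C * R * s (k + 1)) :=
        Finset.sum_le_sum_of_subset_of_nonneg
          (Finset.range_mono (Nat.le_add_left _ _)) fun k _ _ => hb0 _
    _ = ∑ k ∈ Finset.range K, min t (C * R * s (k + 1)) +
        ∑ k ∈ Finset.range F.card, min t (C * R * s (K + k + 1)) := Finset.sum_range_add _ _ _
    _ ≤ K * t + C * R * ∑' k, s (k + K + 1) := by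
        refine add_le_add ?_ ?_
        · have := Finset.sum_le_card_nsmul (Finset.range K)
            (fun k => min t (C * R * s (k + 1))) t fun k _ => min_le_left _ _
          rwa [Finset.card_range, nsmul_eq_mul] at this
        · calc _ ≤ ∑ k ∈ Finset.range F.card, C * R * s (k + K + 1) :=
                Finset.sum_le_sum fun k _ => by rw [add_comm K k]; exact min_le_right _ _
            _ = C * R * ∑ k ∈ Finset.range F.card, s (k + K + 1) := by rw [Finset.mul_sum]
            _ ≤ _ := by
                gcongr
                exact hsumK.sum_le_tsum _ fun k _ => hs0 _
    _ ≤ η := by linarith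

/-- A bounded vector and a bounded functional that takes the value one at it share an index at which
the coefficients of both are large. -/
theorem HasTruncationBound.exists_large_index [IsTopologicalAddGroup E]
    (hT : HasTruncationBound q x xs C) (hC : 0 < C) (hq : IsQuasiNorm 𝕜 q)
    (h : IsBasisWithDual q x xs) (hs0 : ∀ k, 0 ≤ s k) (hsum : Summable fun k => s (k + 1))
    (hs : SumLowerBound q x s) {R H : ℝ} (hR : 0 ≤ R) (hH : 0 < H) :
    ∃ δ : ℝ, 0 < δ ∧ ∀ (g : E) (φ : E →L[𝕜] 𝕜), q g ≤ R → (∀ f, ‖φ f‖ ≤ H * q f) → φ g = 1 →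
      ∃ n, δ ≤ ‖xs n g‖ ∧ δ ≤ ‖φ (x n)‖ := by
  classical
  obtain ⟨κ, hκ, hadd⟩ := hq.add_le
  obtain ⟨X, hX⟩ := h.bounded
  obtain ⟨D, hD⟩ := h.dual_bounded
  set W := max (H * X) 1 with hW
  have hW0 : 0 < W := lt_of_lt_of_le one_pos (le_max_right _ _)
  set D' := max D 1 with hD'
  have hD0 : 0 < D' := lt_of_lt_of_le one_pos (le_max_right _ _)
  set R' := κ * (R + 1) with hR'
  have hR'0 : 0 ≤ R' := by positivity
  obtain ⟨t, ht, hsmall⟩ := hT.exists_sum_coeff_le hC hs0 hsum hs hR'0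
    (η := 1 / (4 * W)) (by positivity)
  set C₂ := C * ∑' k, s (k + 1) with hC₂
  have hC₂0 : 0 ≤ C₂ := mul_nonneg hC.le (tsum_nonneg fun k => hs0 _)
  -- Replacing `g` by a finite combination within `θ` keeps it bounded by `R'`, changes `φ` by at
  -- most `1 / 4`, and changes each coefficient by at most `t / 2`.
  set θ := min 1 (min (1 / (4 * H)) (t / (2 * D'))) with hθ
  have hθ0 : 0 < θ := by positivity
  set δ := min (t / 2) (1 / (4 * (C₂ * R' + 1))) with hδ
  have hδ0 : 0 < δ := by positivity
  refine ⟨δ, hδ0, fun g φ hg hφ hφg => ?_⟩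
  -- Otherwise coefficients up to `t` contribute at most `1 / 4` to `φ g'`, and the larger ones, met
  -- only where `φ (x n)` is below `δ`, at most another `1 / 4`; yet `‖φ g'‖ ≥ 3 / 4`.
  by_contra! hcon
  obtain ⟨g', hg', hgg'⟩ := hq.exists_mem_of_dense h.dense_span g hθ0
  obtain ⟨c, rfl⟩ := (Finsupp.mem_span_range_iff_exists_finsupp).1 hg'
  rw [Finsupp.sum] at hgg'
  set g' := ∑ n ∈ c.support, c n • x n with hg'def
  have hqg' : q g' ≤ R' := by
    have h1 : g' = g + (-1 : 𝕜) • (g - g') := by rw [neg_one_smul]; abel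
    rw [h1]
    refine (hadd _ _).trans ?_
    rw [hq.smul, norm_neg, norm_one, one_mul, hR']
    gcongr
    exact hgg'.le.trans (min_le_left _ _)
  have hcoef : ∀ n ∈ c.support, xs n g' = c n := fun n hn => by
    rw [hg'def, h.apply_sum, if_pos hn]
  have hφg' : 3 / 4 ≤ ‖φ g'‖ := by
    have h1 : ‖φ (g - g')‖ ≤ 1 / 4 := by
      calc ‖φ (g - g')‖ ≤ H * q (g - g') := hφ _
        _ ≤ H * (1 / (4 * H)) := by
          gcongr
          exact hgg'.le.trans ((min_le_right _ _).trans (min_le_left _ _))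
        _ = 1 / 4 := by field_simp
    have h2 : (1 : 𝕜) = φ (g - g') + φ g' := by rw [← map_add, sub_add_cancel, hφg]
    have h3 : ‖(1 : 𝕜)‖ ≤ ‖φ (g - g')‖ + ‖φ g'‖ := by
      conv_lhs => rw [h2]
      exact norm_add_le _ _
    rw [norm_one] at h3
    linarith
  have hφx : ∀ n, ‖φ (x n)‖ ≤ W := fun n =>
    (hφ _).trans ((mul_le_mul_of_nonneg_left (hX n) hH.le).trans (le_max_left _ _))
  have hφsum : ‖φ g'‖ ≤ ∑ n ∈ c.support, ‖c n‖ * ‖φ (x n)‖ := by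
    rw [hg'def, map_sum]
    refine (norm_sum_le _ _).trans (le_of_eq (Finset.sum_congr rfl fun n _ => ?_))
    rw [map_smul, norm_smul]
  have hlow : ∑ n ∈ c.support with ‖c n‖ ≤ t, ‖c n‖ * ‖φ (x n)‖ ≤ 1 / 4 := by
    calc _ ≤ ∑ n ∈ c.support with ‖c n‖ ≤ t, ‖xs n g'‖ * W := by
          refine Finset.sum_le_sum fun n hn => ?_
          rw [hcoef n (Finset.mem_filter.1 hn).1]
          gcongr
          exact hφx n
      _ = (∑ n ∈ c.support with ‖c n‖ ≤ t, ‖xs n g'‖) * W := by rw [Finset.sum_mul]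
      _ ≤ 1 / (4 * W) * W := by
          gcongr
          refine hsmall g' _ hqg' fun n hn => ?_
          rw [hcoef n (Finset.mem_filter.1 hn).1]
          exact (Finset.mem_filter.1 hn).2
      _ = 1 / 4 := by field_simp
  have hhigh : ∑ n ∈ c.support with ¬ ‖c n‖ ≤ t, ‖c n‖ * ‖φ (x n)‖ ≤ 1 / 4 := by
    calc _ ≤ ∑ n ∈ c.support with ¬ ‖c n‖ ≤ t, ‖xs n g'‖ * δ := by
          refine Finset.sum_le_sum fun n hn => ?_
          obtain ⟨hn1, hn2⟩ := Finset.mem_filter.1 hn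
          rw [hcoef n hn1]
          gcongr
          refine (hcon n ?_).le
          have h1 : ‖xs n (g - g')‖ ≤ t / 2 := by
            calc ‖xs n (g - g')‖ ≤ D' * q (g - g') :=
                  (hD n _).trans (mul_le_mul_of_nonneg_right (le_max_left _ _) (hq.nonneg _))
              _ ≤ D' * (t / (2 * D')) := by
                  gcongr
                  exact hgg'.le.trans ((min_le_right _ _).trans (min_le_right _ _))
              _ = t / 2 := by field_simp
          have h2 : ‖c n‖ ≤ ‖xs n (g - g')‖ + ‖xs n g‖ := by
            have : c n = xs n g - xs n (g - g') := by rw [← hcoef n hn1, map_sub]; ring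
            rw [this, add_comm]
            exact norm_sub_le _ _
          have h3 : δ ≤ t / 2 := min_le_left _ _
          rw [not_le] at hn2
          linarith
      _ = (∑ n ∈ c.support with ¬ ‖c n‖ ≤ t, ‖xs n g'‖) * δ := by rw [Finset.sum_mul]
      _ ≤ (C₂ * R' + 1) * (1 / (4 * (C₂ * R' + 1))) := by
          gcongr
          · have h1 := hT.sum_coeff_le hC hq hs0 hsum hs g' (c.support.filter fun n => ¬ ‖c n‖ ≤ t)
            have h2 : C₂ * q g' ≤ C₂ * R' := by gcongr
            linarith
          · exact min_le_right _ _
      _ = 1 / 4 := by field_simp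
  rw [← Finset.sum_filter_add_sum_filter_not c.support (fun n => ‖c n‖ ≤ t)] at hφsum
  linarith

end Coefficients

/-! ### Matching the two families and comparing their sums. -/

section Matching

variable {𝕜 E F N M : Type*} [RCLike 𝕜] [AddCommGroup E] [Module 𝕜 E] [TopologicalSpace E]
  [AddCommGroup F] [Module 𝕜 F] [TopologicalSpace F] {q : E → ℝ} {p : F → ℝ}
  {x : N → E} {xs : N → E →L[𝕜] 𝕜} {Cx : ℝ} {y : M → F} {ys : M → F →L[𝕜] 𝕜} {Cy : ℝ}
  {s : ℕ → ℝ} {J : F →L[𝕜] E} {P : E →L[𝕜] F} {ν : M → N} {δ : ℝ} {K : ℕ}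

/-- The map `ν` sends each member of the family `y` to a member of the family `x` such that each of
the two has a large coefficient with respect to the other, and the fibres of `ν` are uniformly
finite. -/
structure IsMatching (x : N → E) (xs : N → E →L[𝕜] 𝕜) (y : M → F) (ys : M → F →L[𝕜] 𝕜)
    (J : F →L[𝕜] E) (P : E →L[𝕜] F) (ν : M → N) (δ : ℝ) (K : ℕ) : Prop where
  pos : 0 < δ
  card_pos : 0 < K
  le_left : ∀ i, δ ≤ ‖xs (ν i) (J (y i))‖
  le_right : ∀ i, δ ≤ ‖ys i (P (x (ν i)))‖
  card_le : ∀ (n : N) (A : Finset M), (∀ i ∈ A, ν i = n) → A.card ≤ K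

/-- The index `ν i` is a common large index of the vector `J (y i)` and the functional `ys i ∘ P`.
On a fibre over `n`, all coefficients of `P (x n)` are large, so unimodular sums of `y` there are
bounded; aligning signs makes `xs n ∘ J` grow linearly in the size of the fibre, which is therefore
bounded. -/
theorem exists_isMatching [IsTopologicalAddGroup E] (hq : IsQuasiNorm 𝕜 q) (hp : IsQuasiNorm 𝕜 p)
    (hx : IsBasisWithDual q x xs) (hCx : 0 < Cx) (hTx : HasTruncationBound q x xs Cx)
    (hy : IsBasisWithDual p y ys) (hTy : HasTruncationBound p y ys Cy)
    (hs0 : ∀ k, 0 ≤ s k) (hsum : Summable fun k => s (k + 1)) (hs : SumLowerBound q x s)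
    (hPJ : ∀ f, P (J f) = f) :
    ∃ (ν : M → N) (δ : ℝ) (K : ℕ), IsMatching x xs y ys J P ν δ K := by
  obtain ⟨CJ, hCJ, hJ⟩ := hp.exists_bound hq J
  obtain ⟨CP, hCP, hP⟩ := hq.exists_bound hp P
  obtain ⟨X, hX⟩ := hx.bounded
  obtain ⟨Y, hY⟩ := hy.bounded
  obtain ⟨Dx, hDx⟩ := hx.dual_bounded
  obtain ⟨Dy, hDy⟩ := hy.dual_bounded
  obtain ⟨δ, hδ, hlarge⟩ := hTx.exists_large_index hCx hq hx hs0 hsum hs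
    (R := max (CJ * Y) 0) (H := max (Dy * CP) 1) (le_max_right _ _)
    (lt_of_lt_of_le one_pos (le_max_right _ _))
  have hex : ∀ i, ∃ n, δ ≤ ‖xs n (J (y i))‖ ∧ δ ≤ ‖ys i (P (x n))‖ := fun i =>
    hlarge (J (y i)) ((ys i).comp P)
      ((hJ _).trans ((mul_le_mul_of_nonneg_left (hY i) hCJ.le).trans (le_max_left _ _)))
      (fun f => by
        have h1 : ‖ys i (P f)‖ ≤ max (Dy * CP) 1 * q f := by
          rcases le_or_gt 0 Dy with h0 | h0
          · calc ‖ys i (P f)‖ ≤ Dy * p (P f) := hDy _ _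
              _ ≤ Dy * (CP * q f) := mul_le_mul_of_nonneg_left (hP f) h0
              _ = Dy * CP * q f := by ring
              _ ≤ _ := mul_le_mul_of_nonneg_right (le_max_left _ _) (hq.nonneg f)
          · have h2 : Dy * p (P f) ≤ 0 := mul_nonpos_of_nonpos_of_nonneg h0.le (hp.nonneg _)
            exact (hDy _ _).trans (h2.trans
              (mul_nonneg (zero_le_one.trans (le_max_right _ _)) (hq.nonneg f)))
        exact h1)
      (by show ys i (P (J (y i))) = 1; rw [hPJ, hy.apply_self])
  choose ν hν using hex
  have hmain : ∀ (n : N) (A : Finset M), (∀ i ∈ A, ν i = n) → δ * A.card ≤ max Dx 0 *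
      (CJ * (Cy * p (P (x n)) / δ)) := by
    intro n A hA
    set a : M → 𝕜 := fun i => (sgn (xs n (J (y i))))⁻¹ with ha
    have h1 := hTy (P (x n)) A δ a hδ.le (fun i hi => by rw [← hA i hi]; exact (hν i).2)
      (fun i _ => by rw [ha]; dsimp only; rw [norm_inv, norm_sgn, inv_one])
    have h2 : p (∑ i ∈ A, a i • y i) ≤ Cy * p (P (x n)) / δ := by
      rw [le_div_iff₀ hδ]; linarith
    have hmul : ∀ i ∈ A, a i * xs n (J (y i)) = ((‖xs n (J (y i))‖ : ℝ) : 𝕜) := by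
      intro i hi
      have h3 : 0 < ‖xs n (J (y i))‖ := hδ.trans_le (by rw [← hA i hi]; exact (hν i).1)
      have h4 : xs n (J (y i)) ≠ 0 := norm_pos_iff.1 h3
      rw [ha]
      unfold sgn
      dsimp only
      rw [if_neg h4, inv_div, div_mul_cancel₀ _ h4]
    have h3 : xs n (J (∑ i ∈ A, a i • y i)) = ((∑ i ∈ A, ‖xs n (J (y i))‖ : ℝ) : 𝕜) := by
      rw [map_sum, map_sum, RCLike.ofReal_sum]
      exact Finset.sum_congr rfl fun i hi => by
        rw [map_smul, map_smul, smul_eq_mul, hmul i hi]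
    calc δ * A.card = A.card • δ := by rw [nsmul_eq_mul, mul_comm]
      _ ≤ ∑ i ∈ A, ‖xs n (J (y i))‖ := Finset.card_nsmul_le_sum _ _ _ fun i hi => by
          rw [← hA i hi]; exact (hν i).1
      _ ≤ ‖xs n (J (∑ i ∈ A, a i • y i))‖ := by
          rw [h3, RCLike.norm_ofReal]; exact le_abs_self _
      _ ≤ max Dx 0 * q (J (∑ i ∈ A, a i • y i)) :=
          (hDx _ _).trans (mul_le_mul_of_nonneg_right (le_max_left _ _) (hq.nonneg _))
      _ ≤ max Dx 0 * (CJ * (Cy * p (P (x n)) / δ)) := by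
          refine mul_le_mul_of_nonneg_left ((hJ _).trans ?_) (le_max_right _ _)
          exact mul_le_mul_of_nonneg_left h2 hCJ.le
  set G : ℝ := max Dx 0 * (CJ * (max Cy 0 * (CP * X) / δ)) with hG
  refine ⟨ν, δ, ⌈G / δ⌉₊ + 1, hδ, Nat.succ_pos _, fun i => (hν i).1, fun i => (hν i).2,
    fun n A hA => ?_⟩
  have h1 : δ * A.card ≤ G := by
    refine (hmain n A hA).trans ?_
    have h2 : Cy * p (P (x n)) ≤ max Cy 0 * (CP * X) :=
      (mul_le_mul_of_nonneg_right (le_max_left _ _) (hp.nonneg _)).trans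
        (mul_le_mul_of_nonneg_left ((hP _).trans (mul_le_mul_of_nonneg_left (hX n) hCP.le))
          (le_max_right _ _))
    rw [hG]
    gcongr
  have h2 : (A.card : ℝ) ≤ G / δ := by rw [le_div_iff₀ hδ]; linarith
  have h3 : A.card ≤ ⌈G / δ⌉₊ := by exact_mod_cast h2.trans (Nat.le_ceil _)
  omega

theorem exists_pos_mul_le (W : ℝ) {δ : ℝ} (hδ : 0 < δ) : ∃ k : ℕ, 0 < k ∧ 4 * W ≤ k * δ := by
  obtain ⟨k, hk⟩ := exists_nat_ge (4 * W / δ)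
  refine ⟨k + 1, Nat.succ_pos _, ?_⟩
  have h1 := (div_le_iff₀ hδ).1 hk
  push_cast
  linarith

/-- Sums of members of `y` dominate sums of a fixed proportion of members of `x`. -/
theorem IsMatching.exists_sum_le_left (hm : IsMatching x xs y ys J P ν δ K)
    (hq : IsQuasiNorm 𝕜 q) (hp : IsQuasiNorm 𝕜 p)
    (hCx : 0 < Cx) (hTx : HasTruncationBound q x xs Cx)
    (hy : IsBasisWithDual p y ys) (hCy : 0 < Cy) (hTy : HasTruncationBound p y ys Cy)
    (hs0 : ∀ k, 0 ≤ s k) (hsum : Summable fun k => s (k + 1)) (hs : SumLowerBound q x s) :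
    ∃ (D : ℝ) (L : ℕ), 0 < D ∧ ∀ A : Finset M, ∃ B : Finset N,
      A.card ≤ L * B.card ∧ q (∑ n ∈ B, x n) ≤ D * p (∑ i ∈ A, y i) := by
  classical
  obtain ⟨CJ, hCJ, hJ⟩ := hp.exists_bound hq J
  obtain ⟨Y, hY⟩ := hy.bounded
  have hδ := hm.pos
  set C₂ := Cx * ∑' k, s (k + 1) with hC₂
  have hC₂0 : 0 ≤ C₂ := mul_nonneg hCx.le (tsum_nonneg fun k => hs0 _)
  have hfib : ∀ (A : Finset M) (n : N), (A.filter fun i => ν i = n).card ≤ K := fun A n =>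
    hm.card_le n _ fun i hi => (Finset.mem_filter.1 hi).2
  obtain ⟨k, hk, hkW⟩ := exists_pos_mul_le (K * (C₂ * (CJ * Y))) hδ
  refine ⟨Cx * CJ * Cy * (2 / δ), k * k * K, by positivity, fun A => ?_⟩
  obtain ⟨c, hc⟩ := exists_coloring_signs hk hkW (fun i j => xs (ν i) (J (y j))) A
    (fun i _ => hm.le_left i) fun j _ => by
      -- Rows with the same `ν i` repeat a coefficient, at most `K` times.
      rw [← Finset.sum_fiberwise_of_maps_to (t := A.image ν)
        (fun i hi => Finset.mem_image_of_mem ν hi)]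
      calc _ ≤ ∑ n ∈ A.image ν, K * ‖xs n (J (y j))‖ := by
            refine Finset.sum_le_sum fun n _ => ?_
            have h1 : ∑ i ∈ A with ν i = n, ‖xs (ν i) (J (y j))‖
                = ∑ i ∈ A with ν i = n, ‖xs n (J (y j))‖ :=
              Finset.sum_congr rfl fun i hi => by rw [(Finset.mem_filter.1 hi).2]
            rw [h1, Finset.sum_const, nsmul_eq_mul]
            gcongr
            exact hfib A n
        _ = K * ∑ n ∈ A.image ν, ‖xs n (J (y j))‖ := by rw [Finset.mul_sum]
        _ ≤ K * (C₂ * (CJ * Y)) := by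
            gcongr
            refine (hTx.sum_coeff_le hCx hq hs0 hsum hs _ _).trans ?_
            exact mul_le_mul_of_nonneg_left
              ((hJ _).trans (mul_le_mul_of_nonneg_left (hY j) hCJ.le)) hC₂0
  -- One block suffices for a lower estimate: the largest holds at least a `1 / k²` share of `A`.
  obtain ⟨z, -, hz⟩ := Finset.exists_max_image Finset.univ
    (fun z : Fin k × Fin k => (A.filter fun i => c i = z).card)
    ⟨(⟨0, hk⟩, ⟨0, hk⟩), Finset.mem_univ _⟩
  obtain ⟨ε, hε, hlarge⟩ := hc z
  set Z := A.filter fun i => c i = z with hZ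
  refine ⟨Z.image ν, ?_, ?_⟩
  · have h1 : A.card ≤ k * k * Z.card := by
      rw [Finset.card_eq_sum_card_fiberwise (f := c) (t := Finset.univ) (by simp)]
      refine (Finset.sum_le_card_nsmul _ _ _ hz).trans_eq ?_
      simp
    have h2 : Z.card ≤ K * (Z.image ν).card :=
      Finset.card_le_mul_card_image Z K fun n _ => hfib Z n
    calc A.card ≤ k * k * Z.card := h1
      _ ≤ k * k * (K * (Z.image ν).card) := Nat.mul_le_mul_left _ h2
      _ = _ := by ring
  · have h1 : δ / 2 * q (∑ n ∈ Z.image ν, x n) ≤ Cx * q (J (∑ j ∈ Z, ε j • y j)) := by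
      refine hTx.mul_sum_le (by positivity) fun n hn => ?_
      obtain ⟨i, hi, rfl⟩ := Finset.mem_image.1 hn
      obtain ⟨hiA, hiz⟩ := Finset.mem_filter.1 hi
      refine (hlarge i hiA hiz).trans_eq ?_
      rw [map_sum, map_sum]
      congr 1
      refine Finset.sum_congr rfl fun j _ => ?_
      rw [map_smul, map_smul, smul_eq_mul, mul_comm]
    have h2 : p (∑ j ∈ Z, ε j • y j) ≤ Cy * p (∑ i ∈ A, y i) :=
      hTy.combination_le hy (Finset.filter_subset _ _) fun j _ => (hε j).le
    calc q (∑ n ∈ Z.image ν, x n) = 2 / δ * (δ / 2 * q (∑ n ∈ Z.image ν, x n)) := by field_simp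
      _ ≤ 2 / δ * (Cx * (CJ * (Cy * p (∑ i ∈ A, y i)))) := by
          refine mul_le_mul_of_nonneg_left (h1.trans ?_) (by positivity)
          refine mul_le_mul_of_nonneg_left ((hJ _).trans ?_) hCx.le
          gcongr
      _ = _ := by ring

/-- Sums of members of `y` are dominated by sums of at most as many members of `x`. -/
theorem IsMatching.exists_sum_le_right (hm : IsMatching x xs y ys J P ν δ K)
    (hq : IsQuasiNorm 𝕜 q) (hp : IsQuasiNorm 𝕜 p)
    (hx : IsBasisWithDual q x xs) (hCx : 0 < Cx) (hTx : HasTruncationBound q x xs Cx)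
    (hCy : 0 < Cy) (hTy : HasTruncationBound p y ys Cy)
    (hs0 : ∀ k, 0 ≤ s k) (hsum : Summable fun k => s (k + 1)) (hs : SumLowerBound p y s) :
    ∃ D : ℝ, 0 < D ∧ ∀ (A : Finset M) (U : ℝ),
      (∀ B : Finset N, B.card ≤ A.card → q (∑ n ∈ B, x n) ≤ U) → p (∑ i ∈ A, y i) ≤ D * U := by
  classical
  obtain ⟨CP, hCP, hP⟩ := hq.exists_bound hp P
  obtain ⟨X, hX⟩ := hx.bounded
  obtain ⟨κ, hκ, hadd⟩ := hp.add_le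
  have hδ := hm.pos
  have hK : (0 : ℝ) < K := Nat.cast_pos.2 hm.card_pos
  set C₂ := Cy * ∑' k, s (k + 1) with hC₂
  have hC₂0 : 0 ≤ C₂ := mul_nonneg hCy.le (tsum_nonneg fun k => hs0 _)
  obtain ⟨k, hk, hkW⟩ := exists_pos_mul_le (C₂ * (CP * X)) hδ
  have hk' : (0 : ℝ) < k := Nat.cast_pos.2 hk
  refine ⟨κ ^ (k * k) * (k * k * (2 / δ * (Cy * (CP * (K * Cx))))), by positivity,
    fun A U hU => ?_⟩
  obtain ⟨c, hc⟩ := exists_coloring_signs hk hkW (fun i j => ys i (P (x (ν j)))) A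
    (fun i _ => hm.le_right i) fun j _ =>
      (hTy.sum_coeff_le hCy hp hs0 hsum hs _ _).trans (mul_le_mul_of_nonneg_left
        ((hP _).trans (mul_le_mul_of_nonneg_left (hX _) hCP.le)) hC₂0)
  have hclass : ∀ z, p (∑ i ∈ A with c i = z, y i) ≤ 2 / δ * (Cy * (CP * (K * Cx))) * U := by
    intro z
    obtain ⟨ε, hε, hlarge⟩ := hc z
    set Z := A.filter fun i => c i = z with hZ
    have h1 : δ / 2 * p (∑ i ∈ Z, y i) ≤ Cy * p (P (∑ j ∈ Z, ε j • x (ν j))) := by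
      refine hTy.mul_sum_le (by positivity) fun i hi => ?_
      obtain ⟨hiA, hiz⟩ := Finset.mem_filter.1 hi
      refine (hlarge i hiA hiz).trans_eq ?_
      rw [map_sum, map_sum]
      congr 1
      refine Finset.sum_congr rfl fun j _ => ?_
      rw [map_smul, map_smul, smul_eq_mul, mul_comm]
    -- Up to `K` signs accumulate at one `n`; dividing by `K` returns the coefficients to the unit
    -- ball.
    set b : N → 𝕜 := fun n => ((K : ℝ) : 𝕜)⁻¹ * ∑ j ∈ Z with ν j = n, ε j with hb
    have hbn : ∀ n, ‖b n‖ ≤ 1 := fun n => by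
      rw [hb]
      dsimp only
      rw [norm_mul, norm_inv, RCLike.norm_ofReal, abs_of_pos hK, inv_mul_le_iff₀ hK, mul_one]
      calc ‖∑ j ∈ Z with ν j = n, ε j‖ ≤ ∑ j ∈ Z with ν j = n, ‖ε j‖ := norm_sum_le _ _
        _ = (Z.filter fun j => ν j = n).card := by simp [hε]
        _ ≤ K := by
            exact_mod_cast hm.card_le n _ fun i hi => (Finset.mem_filter.1 hi).2
    have hsplit : ∑ j ∈ Z, ε j • x (ν j) = ((K : ℝ) : 𝕜) • ∑ n ∈ Z.image ν, b n • x n := by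
      have hK0 : ((K : ℝ) : 𝕜) ≠ 0 := RCLike.ofReal_ne_zero.2 hK.ne'
      rw [← Finset.sum_fiberwise_of_maps_to (t := Z.image ν)
        (fun i hi => Finset.mem_image_of_mem ν hi), Finset.smul_sum]
      refine Finset.sum_congr rfl fun n _ => ?_
      rw [smul_smul, hb]
      dsimp only
      rw [mul_inv_cancel_left₀ hK0, Finset.sum_smul]
      exact Finset.sum_congr rfl fun j hj => by rw [(Finset.mem_filter.1 hj).2]
    have h2 : q (∑ j ∈ Z, ε j • x (ν j)) ≤ K * Cx * U := by
      rw [hsplit, hq.smul, RCLike.norm_ofReal, abs_of_pos hK, mul_assoc]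
      gcongr
      refine (hTx.combination_le hx subset_rfl fun n _ => hbn n).trans ?_
      gcongr
      exact hU _ (Finset.card_image_le.trans (Finset.card_filter_le _ _))
    calc p (∑ i ∈ Z, y i) = 2 / δ * (δ / 2 * p (∑ i ∈ Z, y i)) := by field_simp
      _ ≤ 2 / δ * (Cy * (CP * (K * Cx * U))) := by
          refine mul_le_mul_of_nonneg_left (h1.trans ?_) (by positivity)
          refine mul_le_mul_of_nonneg_left ((hP _).trans ?_) hCy.le
          gcongr
      _ = _ := by ring
  rw [← Finset.sum_fiberwise A c]
  refine (hp.sum_le hκ hadd _ _).trans ?_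
  have h3 := Finset.sum_le_card_nsmul Finset.univ (fun z => p (∑ i ∈ A with c i = z, y i)) _
    fun z _ => hclass z
  have hcard : (Finset.univ : Finset (Fin k × Fin k)).card = k * k := by simp
  rw [hcard, nsmul_eq_mul, Nat.cast_mul] at h3
  rw [hcard]
  calc _ ≤ κ ^ (k * k) * (k * k * (2 / δ * (Cy * (CP * (K * Cx))) * U)) := by gcongr
    _ = _ := by ring

end Matching

/-! ### Elementary properties of democracy functions. -/

section Democracy

variable {E N : Type*} [AddCommGroup E]

theorem lowerDemocracy_mono (q : E → ℝ) (x : N → E) : Monotone (lowerDemocracy q x) :=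
  fun _ _ h => iInf_mono fun _ => iInf_mono' fun hA => ⟨h.trans hA, le_rfl⟩

theorem lowerDemocracy_card_le (q : E → ℝ) (x : N → E) (A : Finset N) :
    lowerDemocracy q x A.card ≤ ENNReal.ofReal (q (∑ n ∈ A, x n)) :=
  iInf₂_le (f := fun (B : Finset N) (_ : A.card ≤ B.card) => ENNReal.ofReal (q (∑ n ∈ B, x n))) A le_rfl

theorem le_upperDemocracy (q : E → ℝ) (x : N → E) {A : Finset N} {m : ℕ} (hA : A.card ≤ m) :
    ENNReal.ofReal (q (∑ n ∈ A, x n)) ≤ upperDemocracy q x m :=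
  le_iSup₂ (f := fun (A : Finset N) (_ : A.card ≤ m) => ENNReal.ofReal (q (∑ n ∈ A, x n))) A hA

theorem IsDoubling.exists_pow {φ : ℕ → ℝ≥0∞} (h : IsDoubling φ) :
    ∃ C : ℝ≥0, 0 < C ∧ ∀ j m, 1 ≤ m → φ (2 ^ j * m) ≤ (C : ℝ≥0∞) ^ j * φ m := by
  obtain ⟨C, hC, hφ⟩ := h
  refine ⟨C, hC, fun j m hm => ?_⟩
  induction j with
  | zero => simp
  | succ j ih =>
    have h1 : 1 ≤ 2 ^ j * m := Nat.mul_pos (by positivity) hm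
    calc φ (2 ^ (j + 1) * m) = φ (2 * (2 ^ j * m)) := by rw [pow_succ']; ring_nf
      _ ≤ C * φ (2 ^ j * m) := hφ _ h1
      _ ≤ C * ((C : ℝ≥0∞) ^ j * φ m) := by gcongr
      _ = _ := by rw [pow_succ', mul_assoc]

theorem one_le_inv_toReal_mul {a : ℝ≥0∞} (ha : a ≠ 0) {b : ℝ} (h : a ≤ ENNReal.ofReal b) :
    1 ≤ a⁻¹.toReal * b := by
  have htop : a ≠ ⊤ := ne_top_of_le_ne_top ENNReal.ofReal_ne_top h
  have hpos : 0 < a.toReal := ENNReal.toReal_pos ha htop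
  rw [ENNReal.toReal_inv, ← div_eq_inv_mul, one_le_div hpos]
  have hb : 0 < b := ENNReal.ofReal_pos.1 ((pos_iff_ne_zero.2 ha).trans_le h)
  exact ENNReal.toReal_le_of_le_ofReal hb.le h

theorem lowerDemocracy_lesssimOn_upperDemocracy (q : E → ℝ) (x : N → E) :
    LesssimOn {m | 1 ≤ m ∧ (m : ℕ∞) ≤ ENat.card N} (lowerDemocracy q x) (upperDemocracy q x) := by
  refine ⟨1, one_pos, fun m hm => ?_⟩
  obtain ⟨A, rfl⟩ : ∃ A : Finset N, A.card = m := by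
    rcases finite_or_infinite N with hfin | hinf
    · have := Fintype.ofFinite N
      have h1 := hm.2
      rw [ENat.card_eq_coe_fintype_card, Nat.cast_le] at h1
      obtain ⟨A, -, hA⟩ := Finset.exists_subset_card_eq (s := (Finset.univ : Finset N)) h1
      exact ⟨A, hA⟩
    · exact Infinite.exists_subset_card_eq N m
  rw [ENNReal.coe_one, one_mul]
  exact (lowerDemocracy_card_le q x A).trans (le_upperDemocracy q x le_rfl)

end Democracy

/-! ### Comparison of democracy functions and the main theorem. -/

section Comparison

variable {𝕜 E F N M : Type*} [RCLike 𝕜] [AddCommGroup E] [Module 𝕜 E] [TopologicalSpace E]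
  [AddCommGroup F] [Module 𝕜 F] [TopologicalSpace F] {q : E → ℝ} {p : F → ℝ}
  {x : N → E} {y : M → F}

/-- Comparison of the democracy functions of a truncation quasi-greedy basis and of a truncation
quasi-greedy basis of a complemented subspace. -/
theorem lesssimOn_democracy_of_leftInverse [IsTopologicalAddGroup E] [IsTopologicalAddGroup F]
    (hq : IsQuasiNorm 𝕜 q) (hp : IsQuasiNorm 𝕜 p)
    (hx : IsTruncationQuasiGreedyBasis 𝕜 q x) (hy : IsTruncationQuasiGreedyBasis 𝕜 p y)
    (hdoubling : IsDoubling (lowerDemocracy q x))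
    (hsum : ∑' m : ℕ, (lowerDemocracy q x (m + 1))⁻¹ < ∞)
    (J : F →L[𝕜] E) (P : E →L[𝕜] F) (hPJ : ∀ f, P (J f) = f) :
    LesssimOn {m | 1 ≤ m} (lowerDemocracy q x) (lowerDemocracy p y) ∧
      LesssimOn {m | 1 ≤ m} (upperDemocracy p y) (upperDemocracy q x) := by
  obtain ⟨xs, hbx, Cx, hCx, hTx⟩ := hx.exists_hasTruncationBound hq
  obtain ⟨ys, hby, Cy, hCy, hTy⟩ := hy.exists_hasTruncationBound hp
  obtain ⟨C, hC, hpow⟩ := hdoubling.exists_pow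
  set φ := lowerDemocracy q x with hφ
  have hφ0 : ∀ m, 1 ≤ m → φ m ≠ 0 := fun m hm h0 => by
    have := ENNReal.ne_top_of_tsum_ne_top hsum.ne (m - 1)
    rw [Nat.sub_add_cancel hm, h0, ENNReal.inv_zero] at this
    exact this rfl
  -- Where `φ k = ∞` this is `0`, harmlessly, since no set then has `k` elements.
  set s : ℕ → ℝ := fun k => (φ k)⁻¹.toReal with hs
  have hs0 : ∀ k, 0 ≤ s k := fun k => ENNReal.toReal_nonneg
  have hssum : Summable fun k => s (k + 1) := ENNReal.summable_toReal hsum.ne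
  have hsx : SumLowerBound q x s := fun A hA =>
    one_le_inv_toReal_mul (hφ0 _ (Finset.card_pos.2 hA)) (lowerDemocracy_card_le q x A)
  obtain ⟨ν, δ, K, hm⟩ := exists_isMatching hq hp hbx hCx hTx hby hTy hs0 hssum hsx hPJ
  obtain ⟨D, L, hD, hleft⟩ := hm.exists_sum_le_left hq hp hCx hTx hby hCy hTy hs0 hssum hsx
  obtain ⟨j, hj⟩ : ∃ j : ℕ, L ≤ 2 ^ j := ⟨L, Nat.lt_two_pow_self.le⟩
  have hlow : ∀ (A : Finset M) (m : ℕ), 1 ≤ m → m ≤ A.card →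
      φ m ≤ ENNReal.ofReal ((C : ℝ) ^ j * D * p (∑ i ∈ A, y i)) := by
    intro A m hm hA
    obtain ⟨B, hB, hle⟩ := hleft A
    have hB1 : 1 ≤ B.card := by
      by_contra h0
      have h1 : B.card = 0 := by omega
      rw [h1, mul_zero] at hB
      omega
    calc φ m ≤ φ (2 ^ j * B.card) :=
          lowerDemocracy_mono q x (hA.trans (hB.trans (Nat.mul_le_mul_right _ hj)))
      _ ≤ (C : ℝ≥0∞) ^ j * φ B.card := hpow j _ hB1
      _ ≤ (C : ℝ≥0∞) ^ j * ENNReal.ofReal (D * p (∑ i ∈ A, y i)) := by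
          gcongr
          exact (lowerDemocracy_card_le q x B).trans (ENNReal.ofReal_le_ofReal hle)
      _ = _ := by
          rw [mul_assoc, ENNReal.ofReal_mul (pow_nonneg C.coe_nonneg j), ENNReal.ofReal_pow C.coe_nonneg,
            ENNReal.ofReal_coe_nnreal]
  have hC' : 0 < C ^ j * D.toNNReal := mul_pos (pow_pos hC j) (Real.toNNReal_pos.2 hD)
  -- The first inequality gives `y` a summable lower bound of its own, as the reverse comparison
  -- requires.
  have hsy : SumLowerBound p y (fun k => (C : ℝ) ^ j * D * s k) := fun A hA => by
    have h1 := one_le_inv_toReal_mul (hφ0 _ (Finset.card_pos.2 hA))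
      (hlow A A.card (Finset.card_pos.2 hA) le_rfl)
    calc (1 : ℝ) ≤ _ := h1
      _ = _ := by ring
  refine ⟨⟨C ^ j * D.toNNReal, hC', fun m hm => ?_⟩, ?_⟩
  · rw [mul_comm, ← ENNReal.div_le_iff_le_mul (Or.inl (ENNReal.coe_ne_zero.2 hC'.ne'))
      (Or.inl ENNReal.coe_ne_top)]
    refine le_iInf₂ fun A hA => ?_
    rw [ENNReal.div_le_iff_le_mul (Or.inl (ENNReal.coe_ne_zero.2 hC'.ne'))
      (Or.inl ENNReal.coe_ne_top)]
    refine (hlow A m hm hA).trans_eq ?_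
    rw [ENNReal.ofReal_mul (by positivity), mul_comm, ENNReal.ofReal_mul (by positivity),
      ENNReal.ofReal_pow C.coe_nonneg, ENNReal.ofReal_coe_nnreal, ENNReal.coe_mul,
      ENNReal.coe_pow]
    rfl
  · obtain ⟨D', hD', hright⟩ := hm.exists_sum_le_right hq hp hbx hCx hTx hCy hTy
      (s := fun k => (C : ℝ) ^ j * D * s k)
      (fun k => mul_nonneg (by positivity) (hs0 k)) (hssum.mul_left _) hsy
    refine ⟨D'.toNNReal, Real.toNNReal_pos.2 hD', fun m _ => ?_⟩
    by_cases htop : upperDemocracy q x m = ⊤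
    · rw [htop, ENNReal.mul_top (ENNReal.coe_ne_zero.2 (Real.toNNReal_pos.2 hD').ne')]
      exact le_top
    refine iSup₂_le fun A hA => ?_
    have h1 := hright A (upperDemocracy q x m).toReal fun B hB =>
      (ENNReal.ofReal_le_iff_le_toReal htop).1 (le_upperDemocracy q x (hB.trans hA))
    refine (ENNReal.ofReal_le_ofReal h1).trans_eq ?_
    rw [ENNReal.ofReal_mul hD'.le, ENNReal.ofReal_toReal htop]
    rfl

end Comparison

end GreedyBases

/-- The comparison is applied to the closed span with the restricted quasi-norm, its inclusion as
`J` and the projection as `P`; democracy functions of `y` are the same in the span as in `X`. -/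
theorem mainTheorem3 {𝕜 X N M : Type*} [RCLike 𝕜] [AddCommGroup X] [Module 𝕜 X]
    [UniformSpace X] [IsUniformAddGroup X] [ContinuousSMul 𝕜 X] [CompleteSpace X]
    (q : X → ℝ) (hq : GreedyBases.IsQuasiNorm 𝕜 q)
    (x : N → X) (hx : GreedyBases.IsTruncationQuasiGreedyBasis 𝕜 q x)
    (hdoubling : GreedyBases.IsDoubling (GreedyBases.lowerDemocracy q x))
    (hsum : ∑' m : ℕ, (GreedyBases.lowerDemocracy q x (m + 1))⁻¹ < ∞)
    (y : M → X) (hy : GreedyBases.IsTruncationQuasiGreedyBasicSequence 𝕜 q y)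
    (hcompl : (GreedyBases.closedSpan 𝕜 y).ClosedComplemented) :
    GreedyBases.LesssimOn {m | 1 ≤ m}
        (GreedyBases.lowerDemocracy q x) (GreedyBases.lowerDemocracy q y) ∧
      GreedyBases.LesssimOn {m | 1 ≤ m ∧ (m : ℕ∞) ≤ ENat.card M}
        (GreedyBases.lowerDemocracy q y) (GreedyBases.upperDemocracy q y) ∧
      GreedyBases.LesssimOn {m | 1 ≤ m}
        (GreedyBases.upperDemocracy q y) (GreedyBases.upperDemocracy q x) := by
  obtain ⟨P, hP⟩ := hcompl
  have hsumy : ∀ A : Finset M, ((∑ i ∈ A, (⟨y i, GreedyBases.mem_closedSpan 𝕜 y i⟩ :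
      GreedyBases.closedSpan 𝕜 y) : GreedyBases.closedSpan 𝕜 y) : X) = ∑ i ∈ A, y i :=
    fun A => by simp
  have key := GreedyBases.lesssimOn_democracy_of_leftInverse hq
    (hq.restrict (GreedyBases.closedSpan 𝕜 y)) hx hy hdoubling hsum
    (GreedyBases.closedSpan 𝕜 y).subtypeL P hP
  have hl : GreedyBases.lowerDemocracy (fun v : GreedyBases.closedSpan 𝕜 y => q (v : X))
      (fun i => ⟨y i, GreedyBases.mem_closedSpan 𝕜 y i⟩) = GreedyBases.lowerDemocracy q y := by
    funext m
    simp only [GreedyBases.lowerDemocracy, hsumy]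
  have hu : GreedyBases.upperDemocracy (fun v : GreedyBases.closedSpan 𝕜 y => q (v : X))
      (fun i => ⟨y i, GreedyBases.mem_closedSpan 𝕜 y i⟩) = GreedyBases.upperDemocracy q y := by
    funext m
    simp only [GreedyBases.upperDemocracy, hsumy]
  rw [hl, hu] at key
  exact ⟨key.1, GreedyBases.lowerDemocracy_lesssimOn_upperDemocracy q y, key.2⟩
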